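/- Let $C=C^{n+1}\subseteq\mathbb{R}^N$ be a metric cone with vertex $0$: a closed set, invariant under all dilations $y\mapsto y/r$ ($r>0$), which is an $(n+1)$-dimensional manifold with singularities, i.e. the set $\mathrm{Reg}(C)$ of points near which $C$ is a smooth embedded $(n+1)$-dimensional submanifold is dense in $C$ and $\mathcal{H}^n(C\setminus \mathrm{Reg}(C))=0$. (The vertex $0$ may be a singular point.) Let $U\subseteq\mathbb{R}^N$ be open and let $\Sigma=\Sigma^n$ be an area-minimizing hypersurface in $C\cap U$: an integer multiplicity rectifiable $n$-current in $U$ (with locally finite mass) with $\mathrm{spt}\,\Sigma\subseteq C$ and $\partial\Sigma=0$ in $U$, such that $\mathbf{M}_W(\Sigma)\le\mathbf{M}_W(S)$ for every open $W\subset\subset U$ and every integer multiplicity rectifiable $n$-current $S$ in $U$ with $\partial S=\partial\Sigma$ in $U$ and $\mathrm{spt}(S-\Sigma)$ a compact subset of $C\cap W$. Write $\mathrm{Vol}$ for the mass measure of $\Sigma$ (so that $\mathrm{Vol}(B\cap\Sigma)=\mathbf{M}(\Sigma\llcorner B)$), $B_r$ for the open ball of radius $r$ about $0$, and $x^\perp$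 for the component of the position vector $x$ perpendicular to $\Sigma$ in $C$, i.e. the orthogonal projection of $x$ to the orthogonal complement of $T_x\Sigma$ in $T_xC$ (defined for $\mathrm{Vol}$-a.e. $x$). Then for all $0<s<t$ with $\overline{B_t}\subseteq U$ (hence for all $0<s<t$ if $U=\mathbb{R}^N$) the function $|x|^{-n-2}|x^\perp|^2$ is integrable over $(B_t\setminus B_s)\cap\Sigma$ and $$\frac{\mathrm{Vol}(B_t\cap\Sigma)}{t^n}-\frac{\mathrm{Vol}(B_s\cap\Sigma)}{s^n}=\int_{(B_t\setminus B_s)\cap\Sigma}|x|^{-n-2}\,|x^\perp|^2\,d\mathrm{Vol}(x).$$ -/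

import Mathlib

open MeasureTheory Set Metric
open scoped ContDiff

noncomputable section

namespace ConeMonotonicity

/-- The Euclidean space `ℝ^N`. -/
abbrev Euc (N : ℕ) : Type := EuclideanSpace ℝ (Fin N)

/-! ### Submanifolds, tangent spaces and metric cones -/

/-- Near the point `x ∈ A`, the set `A` is an embedded `k`-dimensional submanifold of class `C^r`:
a `C^r` diffeomorphism between open sets of `ℝ^N` straightens `A` to a `k`-dimensional linear
subspace. -/
def IsSubmanifoldAt {N : ℕ} (r : WithTop ℕ∞) (k : ℕ) (A : Set (Euc N)) (x : Euc N) : Prop :=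
  x ∈ A ∧ ∃ (Φ : OpenPartialHomeomorph (Euc N) (Euc N)) (L : Submodule ℝ (Euc N)),
    x ∈ Φ.source ∧ ContDiffOn ℝ r Φ Φ.source ∧ ContDiffOn ℝ r Φ.symm Φ.target ∧
    Module.finrank ℝ L = k ∧ ∀ y ∈ Φ.source, (y ∈ A ↔ Φ y ∈ L)

/-- The regular part of a `k`-dimensional set: the points near which it is a smooth embedded
`k`-dimensional submanifold. -/
def regularPart {N : ℕ} (k : ℕ) (A : Set (Euc N)) : Set (Euc N) :=
  {x | IsSubmanifoldAt ∞ k A x}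

/-- The tangent space `T_x A`, as a linear subspace of `ℝ^N`: the span of the tangent directions of
`A` at `x`. At points where `A` is an embedded `C^1` submanifold this is the usual tangent space. -/
def tangentSpan {N : ℕ} (A : Set (Euc N)) (x : Euc N) : Submodule ℝ (Euc N) :=
  Submodule.span ℝ (tangentConeAt ℝ A x)

/-- A closed subset of `ℝ^N` which is a `(k+1)`-dimensional manifold with singularities: the regular
part is dense in it, and the singular set is `ℋ^k`-null. -/
structure IsSingularManifold {N : ℕ} (k : ℕ) (M : Set (Euc N)) : Prop where
  isClosed : IsClosed M
  subset_closure : M ⊆ closure (regularPart (k + 1) M)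
  singular_null : μHE[k] (M \ regularPart (k + 1) M) = 0

/-- A metric cone `C^{k+1} ⊆ ℝ^N` with vertex `0`: a (complete) `(k+1)`-dimensional manifold with
singularities that is invariant under all the dilations `y ↦ y / r`, `r > 0`. The vertex, and other
points of `C`, may be singular. -/
structure IsMetricCone {N : ℕ} (k : ℕ) (C : Set (Euc N)) : Prop
    extends IsSingularManifold k C where
  dilation_invariant : ∀ r : ℝ, 0 < r → (fun y : Euc N => r⁻¹ • y) '' C = C

/-! ### Differential forms and currents -/

/-- Differential `n`-forms on `ℝ^N`. -/
abbrev Form (N n : ℕ) : Type := Euc N → (Euc N) [⋀^Fin n]→L[ℝ] ℝ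

/-- Smooth forms with compact support contained in `U`. -/
structure IsTestForm {N n : ℕ} (U : Set (Euc N)) (w : Form N n) : Prop where
  contDiff : ContDiff ℝ ∞ w
  hasCompactSupport : HasCompactSupport w
  tsupport_subset : tsupport w ⊆ U

/-- An integer multiplicity rectifiable `n`-current in the open set `U ⊆ ℝ^N`. It is given by a
countably `n`-rectifiable carrier `{x | mult x ≠ 0}`, an integer multiplicity which is locally
`ℋ^n`-summable in `U`, and an orientation `ξ = e_1 ∧ ⋯ ∧ e_n`, where `e_1, …, e_n` is an orthonormal
basis of the approximate tangent space of the carrier at `ℋ^n`-almost every point of it. -/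
structure IntegerCurrent (N n : ℕ) (U : Set (Euc N)) where
  /-- the multiplicity; the carrier is the set where it does not vanish -/
  mult : Euc N → ℤ
  /-- the orienting orthonormal frame -/
  frame : Euc N → Fin n → Euc N
  measurable_mult : Measurable mult
  measurable_frame : Measurable frame
  carrier_subset : ∀ x, mult x ≠ 0 → x ∈ U
  orthonormal : ∀ x, mult x ≠ 0 → Orthonormal ℝ (frame x)
  /-- countable rectifiability, and compatibility of the frame with the tangent planes -/
  rectifiable : ∃ S : ℕ → Set (Euc N),
    (∀ j, ∀ x ∈ S j, IsSubmanifoldAt 1 n (S j) x) ∧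
    μHE[n] ({x | mult x ≠ 0} \ ⋃ j, S j) = 0 ∧
    ∀ j, ∀ᵐ x ∂μHE[n], mult x ≠ 0 → x ∈ S j →
      Submodule.span ℝ (range (frame x)) = tangentSpan (S j) x
  locally_finite : ∀ K : Set (Euc N), IsCompact K → K ⊆ U →
    ∫⁻ x in K, ((mult x).natAbs : ENNReal) ∂μHE[n] < ⊤

namespace IntegerCurrent

variable {N n : ℕ} {U : Set (Euc N)}

/-- The action of the current on forms,
`T(w) = ∫ θ(x) ⟨w(x), e_1(x) ∧ ⋯ ∧ e_n(x)⟩ dℋ^n(x)`. -/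
def eval (T : IntegerCurrent N n U) (w : Form N n) : ℝ :=
  ∫ x, (T.mult x : ℝ) * w x (T.frame x) ∂μHE[n]

/-- The mass (volume) measure `μ_T = |θ| ℋ^n`; the mass of `T` in `W` is `μ_T W`. -/
def mass (T : IntegerCurrent N n U) : Measure (Euc N) :=
  (μHE[n]).withDensity fun x => ((T.mult x).natAbs : ENNReal)

/-- The (approximate) tangent space of the current at `x`. -/
def tangentPlane (T : IntegerCurrent N n U) (x : Euc N) : Submodule ℝ (Euc N) :=
  Submodule.span ℝ (range (T.frame x))

end IntegerCurrent

/-- The support in `U` of a functional on test forms: the complement in `U` of the largest open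
subset of `U` on which the functional vanishes. -/
def supportIn {N n : ℕ} (U : Set (Euc N)) (T : Form N n → ℝ) : Set (Euc N) :=
  {x ∈ U | ∀ V : Set (Euc N), IsOpen V → V ⊆ U → x ∈ V →
    ∃ w : Form N n, IsTestForm V w ∧ T w ≠ 0}

/-- `∂S = ∂T` in `U`, where `∂T(η) = T(dη)` for all test `(n-1)`-forms `η` in `U`; the boundary of a
`0`-current is zero. -/
def SameBoundary {N : ℕ} {U : Set (Euc N)} :
    {n : ℕ} → IntegerCurrent N n U → IntegerCurrent N n U → Prop
  | 0, _, _ => True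
  | n + 1, S, T => ∀ η : Form N n, IsTestForm U η → S.eval (extDeriv η) = T.eval (extDeriv η)

/-- `∂T = 0` in `U`. -/
def HasNoBoundary {N : ℕ} {U : Set (Euc N)} : {n : ℕ} → IntegerCurrent N n U → Prop
  | 0, _ => True
  | n + 1, T => ∀ η : Form N n, IsTestForm U η → T.eval (extDeriv η) = 0

/-- `T` is minimizing in `A`: `𝐌_W(T) ≤ 𝐌_W(S)` whenever `W ⊂⊂ U` is open, `∂S = ∂T` in `U`, and
`spt (S - T)` is a compact subset of `A ∩ W`. -/
def IsMinimizingIn {N n : ℕ} {U : Set (Euc N)} (T : IntegerCurrent N n U) (A : Set (Euc N)) : Prop :=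
  ∀ W : Set (Euc N), IsOpen W → IsCompact (closure W) → closure W ⊆ U →
    ∀ S : IntegerCurrent N n U, SameBoundary S T →
      IsCompact (supportIn U fun w => S.eval w - T.eval w) →
      (supportIn U fun w => S.eval w - T.eval w) ⊆ A ∩ W →
      T.mass W ≤ S.mass W

/-- `x^⊥`: the component of the position vector `x` perpendicular to the current `T` in `C`, that is,
the orthogonal projection of `x` to the orthogonal complement of `T_x Σ` within `T_x C`. -/
def perpIn {N n : ℕ} {U : Set (Euc N)} (C : Set (Euc N)) (T : IntegerCurrent N n U) (x : Euc N) :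
    Euc N :=
  (tangentSpan C x ⊓ (T.tangentPlane x)ᗮ).starProjection x

end ConeMonotonicity

end

/-!
The cone `C` is invariant under the radial diffeomorphisms `F_τ x = exp (τ ψ(|x|²)) x`, where `ψ` is
smooth and `ψ(|x|²)` has compact support in `U`. Hence the push-forward of `T` under `F_τ` is an
admissible competitor for every small `τ` of either sign.

Its mass is given by the area formula (`measure_image_eq_lintegral`), which is proved by flattening
the `C¹` pieces of the carrier. The derivative of `F_τ` at `x` is a multiple of the identity plus a
rank one shear in the direction of `x`, so its volume factor on an `n`-plane is explicit; it depends
only on `|x|` and on the tangential part `x^T` of `x` (`shearJacobian`). Since the mass is minimal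
at `τ = 0`, its derivative there vanishes, which is the first variation formula
`∫ n ψ(|x|²) + 2 ψ'(|x|²) |x^T|² = 0` (`integral_radial_divergence_eq_zero`).

By approximation the formula also holds for the profile `ψ` which vanishes on `[t², ∞)` and has
`ψ'(u) = u ^ (-n/2 - 1) / 2` on `[s², t²)` and `ψ' = 0` on `[0, s²)`. For it, the integrand
equals `t⁻ⁿ` on `B_t`, minus `s⁻ⁿ` on `B_s`, minus `|x|^(-n-2) (|x|² - |x^T|²)` on the
annulus (`annulusDensity`, `integral_annulus_divergence_eq_zero`).

It remains to see that `|x|² - |x^T|² = |x^⊥|²` almost everywhere. This is so because `x ∈ T_x C`,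
as `C` is a cone, and because `T_x Σ ⊆ T_x C` almost everywhere (`ae_tangentPlane_le_tangentSpan`):
almost all of the carrier lies in `C` (`ae_mem_of_supportIn_subset`), hence in the sets `C ∩ S` for
countably many `C¹` submanifolds `S`, and at a density point `x` of `C ∩ S` the directions in which
points of `C ∩ S` approach `x` span `T_x S = T_x Σ`.
-/

/-! ### Comparison of Hausdorff measures -/

namespace ConeMonotonicity

open Filter Topology
open scoped NNReal ENNReal

theorem measure_le_of_countable_cover {X ι : Type*} [MeasurableSpace X] [Countable ι]
    {ν μ : Measure X} {B : ι → Set X} (hB : ∀ i, MeasurableSet (B i))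
    (h : ∀ i A, MeasurableSet A → A ⊆ B i → ν A ≤ μ A)
    {A : Set X} (hA : MeasurableSet A) (hAB : A ⊆ ⋃ i, B i) : ν A ≤ μ A := by
  rcases isEmpty_or_nonempty ι with hι | hι
  · rw [iUnion_of_empty, subset_empty_iff] at hAB
    simp [hAB]
  obtain ⟨u, hu⟩ := exists_surjective_nat ι
  set P : ℕ → Set X := fun k => A ∩ disjointed (B ∘ u) k with hP
  have hPm : ∀ k, MeasurableSet (P k) := fun k =>
    hA.inter (MeasurableSet.disjointed (fun k => hB (u k)) k)
  have hPd : Pairwise (Function.onFun Disjoint P) := fun i j hij =>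
    ((disjoint_disjointed _) hij).mono inter_subset_right inter_subset_right
  have hPU : A = ⋃ k, P k := by
    rw [← inter_iUnion, iUnion_disjointed, eq_comm, inter_eq_left]
    exact hAB.trans_eq (hu.iUnion_comp B).symm
  rw [hPU, measure_iUnion hPd hPm, measure_iUnion hPd hPm]
  exact ENNReal.tsum_le_tsum fun k => h (u k) _ (hPm k)
    (inter_subset_right.trans (disjointed_subset (B ∘ u) k))

/-- An inequality between two measures that holds for small sets near each point of a set `B` holds
for all measurable subsets of `B`. -/
theorem measure_le_of_forall_exists_nhds {X : Type*} [TopologicalSpace X]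
    [SecondCountableTopology X] [MeasurableSpace X] [BorelSpace X] {ν μ : Measure X} {B : Set X}
    (h : ∀ x ∈ B, ∃ V ∈ 𝓝 x, ∀ A, MeasurableSet A → A ⊆ V ∩ B → ν A ≤ μ A)
    {A : Set X} (hA : MeasurableSet A) (hAB : A ⊆ B) : ν A ≤ μ A := by
  choose! V hV hle using h
  obtain ⟨t, htB, htc, hcov⟩ := TopologicalSpace.countable_cover_nhdsWithin
    (f := fun x => interior (V x)) (s := B)
    fun x hx => mem_nhdsWithin_of_mem_nhds (interior_mem_nhds.2 (hV x hx))
  have := htc.to_subtype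
  refine measure_le_of_countable_cover (B := fun x : t => A ∩ interior (V x))
    (fun x => hA.inter isOpen_interior.measurableSet)
    (fun x A' hA' hsub => hle x (htB x.2) A' hA' fun y hy =>
      ⟨interior_subset (hsub hy).2, hAB (hsub hy).1⟩) hA ?_
  rw [← inter_iUnion]
  refine fun y hy => ⟨hy, ?_⟩
  rw [iUnion_coe_set]
  exact hcov (hAB hy)

section Lipschitz

variable {X Y Z : Type*} [MetricSpace X] [MeasurableSpace X] [BorelSpace X]
  [MetricSpace Y] [MeasurableSpace Y] [BorelSpace Y]

theorem _root_.LipschitzOnWith.euclideanHausdorffMeasure_image_le {K : ℝ≥0} {f : X → Y} {s : Set X}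
    (h : LipschitzOnWith K f s) (d : ℕ) : μHE[d] (f '' s) ≤ (K : ℝ≥0∞) ^ d * μHE[d] s := by
  simp_rw [Measure.euclideanHausdorffMeasure_def, Measure.smul_apply]
  have := h.hausdorffMeasure_image_le (d := d) (by positivity)
  rw [ENNReal.rpow_natCast] at this
  simp only [ENNReal.smul_def, smul_eq_mul]
  calc _ ≤ _ := mul_le_mul_right this _
    _ = _ := by ring

/-- If distances between values of `g` on `A` are at most `K` times those between values of `h`,
then the `d`-dimensional measure of `g '' A` is at most `K ^ d` times that of `h '' A`. -/
theorem euclideanHausdorffMeasure_image_le_of_dist_le {K : ℝ≥0} {g : Z → X} {h : Z → Y}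
    {A : Set Z} (hgh : ∀ y ∈ A, ∀ z ∈ A, dist (g y) (g z) ≤ K * dist (h y) (h z)) (d : ℕ) :
    μHE[d] (g '' A) ≤ (K : ℝ≥0∞) ^ d * μHE[d] (h '' A) := by
  rcases isEmpty_or_nonempty Z with hZ | hZ
  · simp [Set.eq_empty_of_isEmpty A]
  have hinv : ∀ y ∈ A, h (Function.invFunOn h A (h y)) = h y := fun y hy =>
    Function.invFunOn_eq ⟨y, hy, rfl⟩
  have hinvA : ∀ y ∈ A, Function.invFunOn h A (h y) ∈ A := fun y hy =>
    Function.invFunOn_mem ⟨y, hy, rfl⟩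
  have hL : LipschitzOnWith K (fun w => g (Function.invFunOn h A w)) (h '' A) := by
    refine LipschitzOnWith.of_dist_le_mul ?_
    rintro _ ⟨y, hy, rfl⟩ _ ⟨z, hz, rfl⟩
    have := hgh _ (hinvA y hy) _ (hinvA z hz)
    rwa [hinv y hy, hinv z hz] at this
  have heq : (fun w => g (Function.invFunOn h A w)) '' (h '' A) = g '' A := by
    rw [image_image]
    refine image_congr fun y hy => ?_
    have := hgh _ (hinvA y hy) y hy
    rw [hinv y hy, dist_self, mul_zero] at this
    exact dist_le_zero.1 this
  rw [← heq]
  exact hL.euclideanHausdorffMeasure_image_le d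

end Lipschitz

/-- The volume factor of a linear map from `ℝⁿ`, for the `n`-dimensional measure. -/
theorem euclideanHausdorffMeasure_image_linearMap {N n : ℕ} (f : Euc n →ₗ[ℝ] Euc N)
    (s : Set (Euc n)) : μHE[n] (f '' s) = ENNReal.ofReal f.normDet * μHE[n] s := by
  have := f.euclideanHausdorffMeasure_image s
  rwa [finrank_euclideanSpace_fin] at this

end ConeMonotonicity

/-! ### Embedded submanifolds and their tangent spaces -/

namespace ConeMonotonicity

open Filter Topology Asymptotics
open scoped NNReal ENNReal

variable {N n : ℕ} {S : Set (Euc N)} {x : Euc N}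

/-- The derivative of a `C¹` local diffeomorphism, as an invertible linear map. -/
theorem exists_hasStrictFDerivAt_equiv {Φ : OpenPartialHomeomorph (Euc N) (Euc N)}
    (hΦ : ContDiffOn ℝ 1 Φ Φ.source) (hΦ' : ContDiffOn ℝ 1 Φ.symm Φ.target) (hx : x ∈ Φ.source) :
    ∃ D : Euc N ≃L[ℝ] Euc N, HasStrictFDerivAt Φ (D : Euc N →L[ℝ] Euc N) x ∧
      HasStrictFDerivAt Φ.symm (D.symm : Euc N →L[ℝ] Euc N) (Φ x) := by
  have h1 : HasStrictFDerivAt Φ (fderiv ℝ Φ x) x :=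
    (hΦ.contDiffAt (Φ.open_source.mem_nhds hx)).hasStrictFDerivAt one_ne_zero
  have h2 : HasStrictFDerivAt Φ.symm (fderiv ℝ Φ.symm (Φ x)) (Φ x) :=
    (hΦ'.contDiffAt (Φ.open_target.mem_nhds (Φ.map_source hx))).hasStrictFDerivAt one_ne_zero
  have h21 : (fderiv ℝ Φ.symm (Φ x)).comp (fderiv ℝ Φ x) = ContinuousLinearMap.id ℝ _ := by
    refine (h2.hasFDerivAt.comp x h1.hasFDerivAt).unique
      ((hasFDerivAt_id x).congr_of_eventuallyEq ?_)
    filter_upwards [Φ.open_source.mem_nhds hx] with y hy using Φ.left_inv hy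
  have h12 : (fderiv ℝ Φ x).comp (fderiv ℝ Φ.symm (Φ x)) = ContinuousLinearMap.id ℝ _ := by
    have h1' : HasFDerivAt Φ (fderiv ℝ Φ x) (Φ.symm (Φ x)) := by
      rw [Φ.left_inv hx]; exact h1.hasFDerivAt
    refine (h1'.comp (Φ x) h2.hasFDerivAt).unique ((hasFDerivAt_id _).congr_of_eventuallyEq ?_)
    filter_upwards [Φ.open_target.mem_nhds (Φ.map_source hx)] with y hy using Φ.right_inv hy
  exact ⟨ContinuousLinearEquiv.equivOfInverse' _ _ h12 h21, h1, h2⟩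

/-- Tangent vectors to a linear subspace belong to it. -/
theorem tangentConeAt_submodule_subset (L : Submodule ℝ (Euc N)) {y : Euc N} (hy : y ∈ L) :
    tangentConeAt ℝ (L : Set (Euc N)) y ⊆ L := by
  intro v hv
  obtain ⟨α, l, hl, c, d, -, hds, hcd⟩ := exists_fun_of_mem_tangentConeAt hv
  refine L.closed_of_finiteDimensional.mem_of_tendsto hcd (hds.mono fun k hk => ?_)
  exact L.smul_mem _ ((Submodule.add_mem_iff_right L hy).1 hk)

theorem subset_tangentConeAt_submodule (L : Submodule ℝ (Euc N)) {y : Euc N} (hy : y ∈ L) :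
    (L : Set (Euc N)) ⊆ tangentConeAt ℝ (L : Set (Euc N)) y := by
  intro v hv
  refine mem_tangentConeAt_of_add_smul_mem (l := 𝓝[≠] (0 : ℝ)) (c := id) ?_ ?_
  · exact tendsto_id
  · exact Eventually.of_forall fun k => L.add_mem hy (L.smul_mem _ hv)

/-- The tangent space of a submanifold is the preimage, under the derivative of a straightening, of
the model subspace. -/
theorem tangentSpan_eq_comap {Φ : OpenPartialHomeomorph (Euc N) (Euc N)}
    {L : Submodule ℝ (Euc N)} {D : Euc N ≃L[ℝ] Euc N} (hxS : x ∈ S) (hx : x ∈ Φ.source)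
    (h1 : HasStrictFDerivAt Φ (D : Euc N →L[ℝ] Euc N) x)
    (h2 : HasStrictFDerivAt Φ.symm (D.symm : Euc N →L[ℝ] Euc N) (Φ x))
    (hΦL : ∀ y ∈ Φ.source, (y ∈ S ↔ Φ y ∈ L)) :
    tangentSpan S x = L.comap (D : Euc N →ₗ[ℝ] Euc N) := by
  have hxL : Φ x ∈ L := (hΦL x hx).1 hxS
  apply le_antisymm
  · refine Submodule.span_le.2 fun v hv => ?_
    rw [← tangentConeAt_inter_nhds (Φ.open_source.mem_nhds hx)] at hv
    have := (h1.hasFDerivAt.hasFDerivWithinAt (s := S ∩ Φ.source)).mapsTo_tangent_cone hv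
    refine tangentConeAt_submodule_subset L hxL (tangentConeAt_mono ?_ this)
    rintro _ ⟨y, hy, rfl⟩
    exact (hΦL y hy.2).1 hy.1
  · intro v hv
    refine Submodule.subset_span ?_
    have hv' : D v ∈ tangentConeAt ℝ ((L : Set (Euc N)) ∩ Φ.target) (Φ x) := by
      rw [tangentConeAt_inter_nhds (Φ.open_target.mem_nhds (Φ.map_source hx))]
      exact subset_tangentConeAt_submodule L hxL hv
    have := (h2.hasFDerivAt.hasFDerivWithinAt
      (s := (L : Set (Euc N)) ∩ Φ.target)).mapsTo_tangent_cone hv'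
    rw [Φ.left_inv hx] at this
    simp only [ContinuousLinearEquiv.coe_coe, ContinuousLinearEquiv.symm_apply_apply] at this
    refine tangentConeAt_mono ?_ this
    rintro _ ⟨y, hy, rfl⟩
    rw [hΦL _ (Φ.map_target hy.2), Φ.right_inv hy.2]
    exact hy.1

/-- Near one of its points `x`, a `C¹` submanifold is flat to first order: the differences `y - z` of
its points are tangent to it at `x` up to an error `o(|y - z|)`. -/
theorem IsSubmanifoldAt.isLittleO_sub_starProjection (hS : IsSubmanifoldAt 1 n S x) :
    (fun p : Euc N × Euc N => (p.1 - p.2) - (tangentSpan S x).starProjection (p.1 - p.2))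
      =o[𝓝 (x, x) ⊓ 𝓟 (S ×ˢ S)] fun p => p.1 - p.2 := by
  obtain ⟨hxS, Φ, L, hx, hΦ, hΦ', -, hΦL⟩ := hS
  obtain ⟨D, h1, h2⟩ := exists_hasStrictFDerivAt_equiv hΦ hΦ' hx
  have hT := tangentSpan_eq_comap hxS hx h1 h2 hΦL
  have ho := (((D.symm : Euc N →L[ℝ] Euc N).isBigO_comp _ _).trans_isLittleO
    h1.isLittleO).mono (inf_le_left (b := 𝓟 (S ×ˢ S)))
  refine IsBigO.trans_isLittleO (IsBigO.of_bound 1 ?_) ho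
  have hsrc : ∀ᶠ p : Euc N × Euc N in 𝓝 (x, x), p ∈ Φ.source ×ˢ Φ.source :=
    (Φ.open_source.prod Φ.open_source).mem_nhds ⟨hx, hx⟩
  filter_upwards [mem_inf_of_left hsrc, mem_inf_of_right (mem_principal_self _)] with p hp hpS
  set v := p.1 - p.2
  set q := D.symm (Φ p.1 - Φ p.2) with hq
  have hqT : q ∈ tangentSpan S x := by
    rw [hT, Submodule.mem_comap]
    simpa [hq] using L.sub_mem ((hΦL _ hp.1).1 hpS.1) ((hΦL _ hp.2).1 hpS.2)
  have h3 : v - (tangentSpan S x).starProjection v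
      = (tangentSpan S x)ᗮ.starProjection (v - q) := by
    rw [Submodule.starProjection_orthogonal_val, map_sub _ v q,
      Submodule.starProjection_eq_self_iff.2 hqT]
    abel
  have h4 : D.symm (Φ p.1 - Φ p.2 - D v) = q - v := by simp [hq]
  rw [h3, one_mul]
  change _ ≤ ‖D.symm (Φ p.1 - Φ p.2 - D v)‖
  rw [h4, norm_sub_rev]
  exact Submodule.norm_starProjection_apply_le _ _

/-- A submanifold is locally closed, hence a Borel set. -/
theorem measurableSet_of_forall_isSubmanifoldAt {r : WithTop ℕ∞}
    (hS : ∀ x ∈ S, IsSubmanifoldAt r n S x) : MeasurableSet S := by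
  have hlc : IsLocallyClosed S := by
    refine ((isLocallyClosed_tfae S).out 0 3).2 fun x hx => ?_
    obtain ⟨-, Φ, L, hxΦ, -, -, -, hΦL⟩ := hS x hx
    refine ⟨Φ.source, hxΦ, Φ.open_source, fun y hy => ?_⟩
    have hy1 : y ∈ closure (Φ.source ∩ S) := Φ.open_source.inter_closure hy
    rw [hΦL y hy.1]
    have hc : ContinuousWithinAt Φ (Φ.source ∩ S) y :=
      (Φ.continuousAt hy.1).continuousWithinAt
    refine L.closed_of_finiteDimensional.closure_subset_iff.2 ?_ (hc.mem_closure_image hy1)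
    rintro _ ⟨z, hz, rfl⟩
    exact (hΦL z hz.1).1 hz.2
  obtain ⟨A, B, hA, hB, rfl⟩ := hlc
  exact hA.measurableSet.inter hB.measurableSet

theorem IsSubmanifoldAt.image_homeomorph {r : WithTop ℕ∞} (hS : IsSubmanifoldAt r n S x)
    (F : Euc N ≃ₜ Euc N) (hF : ContDiff ℝ r F) (hF' : ContDiff ℝ r F.symm) :
    IsSubmanifoldAt r n (F '' S) (F x) := by
  obtain ⟨hxS, Φ, L, hx, hΦ, hΦ', hL, hΦL⟩ := hS
  refine ⟨mem_image_of_mem _ hxS, F.symm.transOpenPartialHomeomorph Φ, L, ?_, ?_, ?_, hL, ?_⟩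
  · simpa using hx
  · exact hΦ.comp hF'.contDiffOn fun y hy => hy
  · exact hF.comp_contDiffOn hΦ'
  · intro y hy
    have h1 : y ∈ F '' S ↔ F.symm y ∈ S := by
      rw [F.image_eq_preimage_symm]; rfl
    exact h1.trans (hΦL (F.symm y) hy)

theorem tangentSpan_image_homeomorph (F : Euc N ≃ₜ Euc N) (hF : ContDiff ℝ 1 F)
    (hF' : ContDiff ℝ 1 F.symm) (A : Set (Euc N)) (x : Euc N) :
    tangentSpan (F '' A) (F x) = (tangentSpan A x).map (fderiv ℝ F x : Euc N →ₗ[ℝ] Euc N) := by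
  have h1 : HasFDerivAt F (fderiv ℝ F x) x := (hF.differentiable one_ne_zero x).hasFDerivAt
  have h2 : HasFDerivAt F.symm (fderiv ℝ F.symm (F x)) (F x) :=
    (hF'.differentiable one_ne_zero _).hasFDerivAt
  have h12 : (fderiv ℝ F x).comp (fderiv ℝ F.symm (F x)) = ContinuousLinearMap.id ℝ _ := by
    have h1' : HasFDerivAt F (fderiv ℝ F x) (F.symm (F x)) := by simpa using h1
    refine (h1'.comp (F x) h2).unique ((hasFDerivAt_id _).congr_of_eventuallyEq ?_)
    exact Eventually.of_forall fun y => F.apply_symm_apply y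
  apply le_antisymm
  · refine Submodule.span_le.2 fun v hv => ?_
    have := (h2.hasFDerivWithinAt (s := F '' A)).mapsTo_tangent_cone hv
    have hFA : F.symm '' (F '' A) = A := F.toEquiv.symm_image_image A
    rw [hFA, F.symm_apply_apply] at this
    exact ⟨_, Submodule.subset_span this, congr($h12 v)⟩
  · rw [tangentSpan, Submodule.map_span, Submodule.span_le]
    rintro _ ⟨v, hv, rfl⟩
    exact Submodule.subset_span (h1.hasFDerivWithinAt.mapsTo_tangent_cone hv)

/-- The infinitesimal area formula: near the point `x` of a `C¹` submanifold `S` of dimension `n`, a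
map `F` with injective derivative changes the `n`-dimensional measure of subsets of `S` by a factor
which is close to the volume factor of its derivative on the tangent space. -/
theorem IsSubmanifoldAt.exists_nhds_measure_image_le (hS : IsSubmanifoldAt 1 n S x)
    (ι : Euc n →ₗᵢ[ℝ] Euc N) (hι : LinearMap.range ι.toLinearMap = tangentSpan S x)
    {F : Euc N → Euc N} {D : Euc N →L[ℝ] Euc N} (hF : HasStrictFDerivAt F D x)
    (hD : Function.Injective D) {c : ℝ≥0} (hc : 1 < c) :
    ∃ V ∈ 𝓝 x, ∀ A ⊆ V ∩ S,
      μHE[n] (F '' A) ≤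
        (c : ℝ≥0∞) ^ n * (ENNReal.ofReal (D.toLinearMap ∘ₗ ι.toLinearMap).normDet * μHE[n] A) ∧
      ENNReal.ofReal (D.toLinearMap ∘ₗ ι.toLinearMap).normDet * μHE[n] A ≤
        (c : ℝ≥0∞) ^ n * ((c : ℝ≥0∞) ^ n * μHE[n] (F '' A)) := by
  -- `P` is the orthogonal projection onto the tangent space, in the coordinates given by `ι`.
  set P : Euc N →L[ℝ] Euc n := ContinuousLinearMap.adjoint ι.toContinuousLinearMap with hP
  have hιP : ∀ v, ι (P v) = (tangentSpan S x).starProjection v := by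
    intro v
    refine (Submodule.eq_starProjection_of_mem_of_inner_eq_zero ?_ ?_).symm
    · rw [← hι]; exact ⟨_, rfl⟩
    · rw [← hι]
      rintro _ ⟨w, rfl⟩
      have : inner ℝ v (ι w) = inner ℝ (P v) w := by
        rw [hP, ContinuousLinearMap.adjoint_inner_left]; rfl
      rw [inner_sub_left, sub_eq_zero]
      exact this.trans (ι.inner_map_map _ _).symm
  set l := 𝓝 (x, x) ⊓ 𝓟 (S ×ˢ S)
  have hflat : (fun p : Euc N × Euc N => (p.1 - p.2) - ι (P (p.1 - p.2))) =o[l]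
      fun p => p.1 - p.2 := by
    simpa only [hιP] using hS.isLittleO_sub_starProjection
  have hFl : (fun p : Euc N × Euc N => F p.1 - F p.2 - D (ι (P (p.1 - p.2)))) =o[l]
      fun p => p.1 - p.2 := by
    have h1 := hF.isLittleO.mono (inf_le_left (b := 𝓟 (S ×ˢ S)))
    have h2 := (D.isBigO_comp _ _).trans_isLittleO hflat
    refine (h1.add h2).congr_left fun p => ?_
    simp only [map_sub]
    abel
  obtain ⟨K, hK, hDK⟩ := D.toLinearMap.exists_antilipschitzWith (LinearMap.ker_eq_bot.2 hD)
  have hDK' : ∀ v, ‖v‖ ≤ K * ‖D v‖ := fun v => by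
    simpa using hDK.le_mul_dist v 0
  have hc0 : (0 : ℝ) < c := by exact_mod_cast zero_lt_one.trans hc
  have hc1 : (1 : ℝ) < c := by exact_mod_cast hc
  have hKr : (0 : ℝ) < K := by exact_mod_cast hK
  set ε : ℝ := min (1 - (c : ℝ)⁻¹) ((1 - (c : ℝ)⁻¹) / (c * K)) with hε
  have hci : (c : ℝ)⁻¹ < 1 := inv_lt_one_of_one_lt₀ hc1
  have hε0 : 0 < ε := lt_min (by linarith) (div_pos (by linarith) (by positivity))
  have hε1 : ε ≤ 1 - (c : ℝ)⁻¹ := min_le_left _ _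
  have hε2 : ε * (c * K) ≤ 1 - (c : ℝ)⁻¹ := by
    rw [← le_div_iff₀ (by positivity)]; exact min_le_right _ _
  have hcc : (c : ℝ) * (c : ℝ)⁻¹ = 1 := mul_inv_cancel₀ hc0.ne'
  -- Quantitative form of the two asymptotic statements.
  have hev := (hflat.def hε0).and (hFl.def hε0)
  obtain ⟨V, hV, hVS⟩ : ∃ V ∈ 𝓝 x, ∀ y ∈ V ∩ S, ∀ z ∈ V ∩ S,
      ‖(y - z) - ι (P (y - z))‖ ≤ ε * ‖y - z‖ ∧
      ‖F y - F z - D (ι (P (y - z)))‖ ≤ ε * ‖y - z‖ := by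
    rw [eventually_inf_principal, nhds_prod_eq, eventually_prod_self_iff'] at hev
    obtain ⟨V, hV, h⟩ := hev
    exact ⟨V, hV, fun y hy z hz => h y hy.1 z hz.1 ⟨hy.2, hz.2⟩⟩
  have key : ∀ y ∈ V ∩ S, ∀ z ∈ V ∩ S, ‖y - z‖ ≤ c * ‖P (y - z)‖ ∧
      ‖P (y - z)‖ ≤ ‖y - z‖ ∧
      ‖F y - F z‖ ≤ c * ‖D (ι (P (y - z)))‖ ∧ ‖D (ι (P (y - z)))‖ ≤ c * ‖F y - F z‖ := by
    intro y hy z hz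
    obtain ⟨h1, h2⟩ := hVS y hy z hz
    set v := y - z
    have h3 : ‖ι (P v)‖ = ‖P v‖ := ι.norm_map _
    have h4 : ‖P v‖ ≤ ‖v‖ := by
      rw [← h3, hιP]; exact Submodule.norm_starProjection_apply_le _ _
    have h5 : ‖v‖ ≤ c * ‖P v‖ := by
      have : ‖v‖ ≤ ‖v - ι (P v)‖ + ‖ι (P v)‖ := norm_le_norm_sub_add _ _
      rw [h3] at this
      have h6 : (c : ℝ)⁻¹ * ‖v‖ ≤ ‖P v‖ := by nlinarith [norm_nonneg v]
      calc ‖v‖ = c * ((c : ℝ)⁻¹ * ‖v‖) := by rw [← mul_assoc, hcc, one_mul]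
        _ ≤ _ := by gcongr
    have h7 : ‖P v‖ ≤ K * ‖D (ι (P v))‖ := h3 ▸ hDK' (ι (P v))
    have h8 : ε * ‖v‖ ≤ (1 - (c : ℝ)⁻¹) * ‖D (ι (P v))‖ := by
      calc ε * ‖v‖ ≤ ε * (c * (K * ‖D (ι (P v))‖)) := by gcongr; exact h5.trans (by gcongr)
        _ = ε * (c * K) * ‖D (ι (P v))‖ := by ring
        _ ≤ _ := by gcongr
    have h9 : 1 - (c : ℝ)⁻¹ ≤ c - 1 := by
      nlinarith [sq_nonneg ((c : ℝ) - 1), inv_pos.2 hc0]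
    have h10 : 0 ≤ ‖D (ι (P v))‖ := norm_nonneg _
    refine ⟨h5, h4, ?_, ?_⟩
    · have := norm_le_norm_sub_add (F y - F z) (D (ι (P v)))
      nlinarith
    · have := norm_le_norm_sub_add (D (ι (P v))) (F y - F z)
      rw [norm_sub_rev] at this
      have h11 : (c : ℝ)⁻¹ * ‖D (ι (P v))‖ ≤ ‖F y - F z‖ := by nlinarith
      calc ‖D (ι (P v))‖ = c * ((c : ℝ)⁻¹ * ‖D (ι (P v))‖) := by rw [← mul_assoc, hcc, one_mul]
        _ ≤ _ := by gcongr
  refine ⟨V, hV, fun A hA => ?_⟩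
  have hlin : μHE[n] ((fun y => D (ι (P y))) '' A) =
      ENNReal.ofReal (D.toLinearMap ∘ₗ ι.toLinearMap).normDet * μHE[n] (P '' A) := by
    rw [← euclideanHausdorffMeasure_image_linearMap, image_image]
    rfl
  have hPA : μHE[n] (P '' A) ≤ μHE[n] A := by
    have := euclideanHausdorffMeasure_image_le_of_dist_le (K := 1) (g := P) (h := id) (A := A)
      (fun y hy z hz => by
        rw [dist_eq_norm, dist_eq_norm, ← map_sub]
        simpa using (key y (hA hy) z (hA hz)).2.1) n
    simpa using this
  have hAP : μHE[n] A ≤ (c : ℝ≥0∞) ^ n * μHE[n] (P '' A) := by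
    have := euclideanHausdorffMeasure_image_le_of_dist_le (K := c) (g := id) (h := P) (A := A)
      (fun y hy z hz => by
        rw [dist_eq_norm, dist_eq_norm, ← map_sub]
        exact (key y (hA hy) z (hA hz)).1) n
    simpa using this
  have hFA : μHE[n] (F '' A) ≤ (c : ℝ≥0∞) ^ n * μHE[n] ((fun y => D (ι (P y))) '' A) :=
    euclideanHausdorffMeasure_image_le_of_dist_le
      (fun y hy z hz => by
        rw [dist_eq_norm, dist_eq_norm]
        simpa using (key y (hA hy) z (hA hz)).2.2.1) n
  have hAF : μHE[n] ((fun y => D (ι (P y))) '' A) ≤ (c : ℝ≥0∞) ^ n * μHE[n] (F '' A) :=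
    euclideanHausdorffMeasure_image_le_of_dist_le
      (fun y hy z hz => by
        rw [dist_eq_norm, dist_eq_norm]
        simpa using (key y (hA hy) z (hA hz)).2.2.2) n
  constructor
  · refine hFA.trans ?_
    rw [hlin]
    gcongr
  · calc _ ≤ ENNReal.ofReal (D.toLinearMap ∘ₗ ι.toLinearMap).normDet *
          ((c : ℝ≥0∞) ^ n * μHE[n] (P '' A)) := by gcongr
      _ = (c : ℝ≥0∞) ^ n * μHE[n] ((fun y => D (ι (P y))) '' A) := by rw [hlin]; ring
      _ ≤ _ := by gcongr

end ConeMonotonicity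

/-! ### The area formula on rectifiable sets -/

namespace ConeMonotonicity

open Filter Topology Asymptotics
open scoped NNReal ENNReal

variable {N n : ℕ}

/-- The linear map `ℝⁿ → ℝᴺ` that sends the standard basis to the given vectors. -/
noncomputable def frameMap (e : Fin n → Euc N) : Euc n →ₗ[ℝ] Euc N :=
  (EuclideanSpace.basisFun (Fin n) ℝ).toBasis.constr ℝ e

theorem frameMap_basis (e : Fin n → Euc N) (i : Fin n) :
    frameMap e (EuclideanSpace.basisFun (Fin n) ℝ i) = e i := by
  have := (EuclideanSpace.basisFun (Fin n) ℝ).toBasis.constr_basis ℝ e i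
  rwa [OrthonormalBasis.coe_toBasis] at this

theorem range_frameMap (e : Fin n → Euc N) :
    LinearMap.range (frameMap e) = Submodule.span ℝ (range e) :=
  (EuclideanSpace.basisFun (Fin n) ℝ).toBasis.constr_range ℝ

theorem exists_linearIsometry_eq_frameMap {e : Fin n → Euc N} (he : Orthonormal ℝ e) :
    ∃ ι : Euc n →ₗᵢ[ℝ] Euc N, ι.toLinearMap = frameMap e := by
  refine ⟨(frameMap e).isometryOfOrthonormal (v := (EuclideanSpace.basisFun (Fin n) ℝ).toBasis)
    ?_ ?_, rfl⟩
  · rw [OrthonormalBasis.coe_toBasis]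
    exact (EuclideanSpace.basisFun (Fin n) ℝ).orthonormal
  · convert he
    ext1 i
    simp only [Function.comp_apply, OrthonormalBasis.coe_toBasis, frameMap_basis]

/-- The set `E` is countably `n`-rectifiable: almost all of it is covered by the `C¹` submanifolds
`S j`, and at almost every point of `E ∩ S j` the frame `e` spans the tangent space of `S j`. -/
structure IsRectifiableWithFrame (E : Set (Euc N)) (e : Euc N → Fin n → Euc N)
    (S : ℕ → Set (Euc N)) : Prop where
  isSubmanifoldAt : ∀ j, ∀ x ∈ S j, IsSubmanifoldAt 1 n (S j) x
  measure_diff : μHE[n] (E \ ⋃ j, S j) = 0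
  span_frame : ∀ j, ∀ᵐ x ∂μHE[n], x ∈ E → x ∈ S j →
    Submodule.span ℝ (range (e x)) = tangentSpan (S j) x

/-- A rectifiable set consists of a null set and countably many Borel sets `B j`, each contained in a
submanifold whose tangent spaces at all points of `B j` are spanned by the frame. -/
theorem IsRectifiableWithFrame.exists_cover {E : Set (Euc N)} {e : Euc N → Fin n → Euc N}
    {S : ℕ → Set (Euc N)} (h : IsRectifiableWithFrame E e S) (hE : MeasurableSet E) :
    ∃ (Z : Set (Euc N)) (B : ℕ → Set (Euc N)), MeasurableSet Z ∧ μHE[n] Z = 0 ∧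
      (∀ j, MeasurableSet (B j)) ∧ (∀ j, B j ⊆ E ∩ S j) ∧ E ⊆ Z ∪ ⋃ j, B j ∧
      ∀ j, ∀ x ∈ B j, Submodule.span ℝ (range (e x)) = tangentSpan (S j) x := by
  have hb := fun j => ae_iff.1 (h.span_frame j)
  set bad : ℕ → Set (Euc N) := fun j => toMeasurable μHE[n] {x | ¬ (x ∈ E → x ∈ S j →
    Submodule.span ℝ (range (e x)) = tangentSpan (S j) x)} with hbad
  have hbad0 : ∀ j, μHE[n] (bad j) = 0 := fun j => by rw [hbad, measure_toMeasurable, hb j]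
  have hSm : ∀ j, MeasurableSet (S j) := fun j =>
    measurableSet_of_forall_isSubmanifoldAt (h.isSubmanifoldAt j)
  refine ⟨(E \ ⋃ j, S j) ∪ ⋃ j, bad j, fun j => (E ∩ S j) \ bad j, ?_, ?_, ?_, ?_, ?_, ?_⟩
  · exact (hE.diff (MeasurableSet.iUnion hSm)).union
      (MeasurableSet.iUnion fun j => measurableSet_toMeasurable _ _)
  · exact measure_union_null h.measure_diff (measure_iUnion_null hbad0)
  · exact fun j => (hE.inter (hSm j)).diff (measurableSet_toMeasurable _ _)
  · exact fun j => sdiff_subset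
  · intro x hx
    by_cases hxS : x ∈ ⋃ j, S j
    · obtain ⟨j, hj⟩ := mem_iUnion.1 hxS
      by_cases hxb : x ∈ bad j
      · exact Or.inl (Or.inr (mem_iUnion.2 ⟨j, hxb⟩))
      · exact Or.inr (mem_iUnion.2 ⟨j, ⟨hx, hj⟩, hxb⟩)
    · exact Or.inl (Or.inl ⟨hx, hxS⟩)
  · intro j x hx
    by_contra hcon
    exact hx.2 (subset_toMeasurable _ _ fun hc => hcon (hc hx.1.1 hx.1.2))

/-- The area formula for a diffeomorphism, on the subsets of a rectifiable set. -/
theorem measure_image_eq_lintegral {E : Set (Euc N)} {e : Euc N → Fin n → Euc N}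
    {S : ℕ → Set (Euc N)} (h : IsRectifiableWithFrame E e S) (hE : MeasurableSet E)
    (he : ∀ x ∈ E, Orthonormal ℝ (e x)) (F : Euc N ≃ₜ Euc N) (hF : ContDiff ℝ 1 F)
    (hFi : ∀ x, Function.Injective (fderiv ℝ F x)) {K : ℝ≥0} (hK : LipschitzWith K F)
    {J : Euc N → ℝ≥0} (hJ : Measurable J) (hJpos : ∀ x ∈ E, 0 < J x)
    (hJe : ∀ x ∈ E, (J x : ℝ) = ((fderiv ℝ F x).toLinearMap ∘ₗ frameMap (e x)).normDet)
    {A : Set (Euc N)} (hA : MeasurableSet A) (hAE : A ⊆ E) :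
    μHE[n] (F '' A) = ∫⁻ x in A, J x ∂μHE[n] := by
  obtain ⟨Z, B, hZ, hZ0, hB, hBS, hEZB, hBT⟩ := h.exists_cover hE
  set ν : Measure (Euc N) := μHE[n].map F.symm with hν
  have hνA : ∀ A, ν A = μHE[n] (F '' A) := fun A => by
    rw [hν, ← F.symm.toMeasurableEquiv_coe, MeasurableEquiv.map_apply,
      F.symm.toMeasurableEquiv_coe, F.image_eq_preimage_symm]
  set m : Measure (Euc N) := μHE[n].withDensity fun x => (J x : ℝ≥0∞) with hm
  have hmA : ∀ A, MeasurableSet A → m A = ∫⁻ x in A, J x ∂μHE[n] := fun A hA =>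
    withDensity_apply _ hA
  have hν0 : ∀ A, μHE[n] A = 0 → ν A = 0 := fun A hA0 => by
    have := (hK.lipschitzOnWith (s := A)).euclideanHausdorffMeasure_image_le n
    rw [hA0, mul_zero] at this
    rw [hνA]
    exact le_antisymm this zero_le
  have hm0 : ∀ A, μHE[n] A = 0 → m A = 0 := fun A hA0 => withDensity_absolutelyContinuous _ _ hA0
  -- Cut the good part of `E` into pieces on which the volume factor is almost constant.
  have main : ∀ c : ℝ≥0, 1 < c →
      ν A ≤ ((c : ℝ≥0∞) ^ n * c) * m A ∧ m A ≤ ((c : ℝ≥0∞) ^ n * c ^ n * c) * ν A := by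
    intro c hc
    have hc0 : c ≠ 0 := (zero_lt_one.trans hc).ne'
    set Q : Option (ℕ × ℤ) → Set (Euc N) := fun q => q.elim Z fun q =>
      B q.1 ∩ J ⁻¹' Ico (c ^ q.2) (c ^ (q.2 + 1)) with hQ
    have hQm : ∀ q, MeasurableSet (Q q) := by
      rintro (_ | q)
      · exact hZ
      · exact (hB _).inter (hJ measurableSet_Ico)
    have hAQ : A ⊆ ⋃ q, Q q := by
      intro x hx
      rcases hEZB (hAE hx) with hxZ | hxB
      · exact mem_iUnion.2 ⟨none, hxZ⟩
      · obtain ⟨j, hj⟩ := mem_iUnion.1 hxB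
        obtain ⟨k, hk⟩ := exists_mem_Ico_zpow (hJpos x (hAE hx)) hc
        exact mem_iUnion.2 ⟨some (j, k), hj, hk⟩
    have hloc : ∀ (q : ℕ × ℤ), ∀ x ∈ Q (some q), ∃ V ∈ 𝓝 x, ∀ A, MeasurableSet A →
        A ⊆ V ∩ Q (some q) →
        ν A ≤ ((c : ℝ≥0∞) ^ n * c) * m A ∧ m A ≤ ((c : ℝ≥0∞) ^ n * c ^ n * c) * ν A := by
      rintro ⟨j, k⟩ x ⟨hxB, hxJ⟩
      have hxE := (hBS j hxB).1
      obtain ⟨ι, hι⟩ := exists_linearIsometry_eq_frameMap (he x hxE)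
      have hS := h.isSubmanifoldAt j x (hBS j hxB).2
      obtain ⟨V, hV, hVA⟩ := hS.exists_nhds_measure_image_le ι
        (by rw [hι, range_frameMap, hBT j x hxB]) (hF.contDiffAt.hasStrictFDerivAt one_ne_zero)
        (hFi x) hc
      refine ⟨V, hV, fun A hA hAV => ?_⟩
      obtain ⟨h1, h2⟩ := hVA A fun y hy => ⟨(hAV hy).1, (hBS j (hAV hy).2.1).2⟩
      have hJx : ENNReal.ofReal ((fderiv ℝ F x).toLinearMap ∘ₗ ι.toLinearMap).normDet = J x := by
        rw [hι, ← hJe x hxE, ENNReal.ofReal_coe_nnreal]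
      rw [hJx] at h1 h2
      have h3 : (J x : ℝ≥0∞) * μHE[n] A ≤ c * m A := by
        rw [hmA A hA, ← lintegral_const_mul _ hJ.coe_nnreal_ennreal, ← setLIntegral_const]
        refine setLIntegral_mono (hJ.coe_nnreal_ennreal.const_mul _) fun y hy => ?_
        have hy' := (hAV hy).2.2
        rw [← ENNReal.coe_mul, ENNReal.coe_le_coe]
        calc J x ≤ c ^ (k + 1) := hxJ.2.le
          _ = c * c ^ k := by rw [zpow_add_one₀ hc0, mul_comm]
          _ ≤ c * J y := by gcongr; exact hy'.1
      have h4 : m A ≤ c * (J x * μHE[n] A) := by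
        rw [hmA A hA, ← mul_assoc, ← setLIntegral_const]
        refine setLIntegral_mono measurable_const fun y hy => ?_
        have hy' := (hAV hy).2.2
        rw [← ENNReal.coe_mul, ENNReal.coe_le_coe]
        calc J y ≤ c ^ (k + 1) := hy'.2.le
          _ = c * c ^ k := by rw [zpow_add_one₀ hc0, mul_comm]
          _ ≤ c * J x := by gcongr; exact hxJ.1
      rw [hνA]
      constructor
      · calc _ ≤ _ := h1
          _ ≤ (c : ℝ≥0∞) ^ n * (c * m A) := by gcongr
          _ = _ := by ring
      · calc _ ≤ _ := h4
          _ ≤ c * ((c : ℝ≥0∞) ^ n * (c ^ n * μHE[n] (F '' A))) := by gcongr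
          _ = _ := by ring
    constructor
    · refine measure_le_of_countable_cover (μ := ((c : ℝ≥0∞) ^ n * c) • m) hQm ?_ hA hAQ
      rintro (_ | q) A' hA' hA'Q
      · simp [hν0 A' (measure_mono_null hA'Q hZ0)]
      · refine measure_le_of_forall_exists_nhds (fun x hx => ?_) hA' hA'Q
        obtain ⟨V, hV, hVA⟩ := hloc q x hx
        exact ⟨V, hV, fun A'' h1 h2 => (hVA A'' h1 h2).1⟩
    · refine measure_le_of_countable_cover (μ := ((c : ℝ≥0∞) ^ n * c ^ n * c) • ν) hQm ?_ hA hAQ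
      rintro (_ | q) A' hA' hA'Q
      · simp [hm0 A' (measure_mono_null hA'Q hZ0)]
      · refine measure_le_of_forall_exists_nhds (fun x hx => ?_) hA' hA'Q
        obtain ⟨V, hV, hVA⟩ := hloc q x hx
        exact ⟨V, hV, fun A'' h1 h2 => (hVA A'' h1 h2).2⟩
  rw [← hνA, ← hmA A hA]
  have hlim : Tendsto (fun c : ℝ≥0 => (c : ℝ≥0∞)) (𝓝[>] 1) (𝓝 1) :=
    (ENNReal.continuous_coe.tendsto 1).mono_left nhdsWithin_le_nhds
  have hpow : ∀ k, Tendsto (fun c : ℝ≥0 => (c : ℝ≥0∞) ^ k) (𝓝[>] 1) (𝓝 1) := fun k => by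
    have := ((ENNReal.continuous_pow k).tendsto 1).comp hlim
    rwa [one_pow] at this
  -- Both inequalities follow by letting `c` decrease to `1`.
  apply le_antisymm
  · have hl : Tendsto (fun c : ℝ≥0 => ((c : ℝ≥0∞) ^ n * c) * m A) (𝓝[>] 1) (𝓝 (m A)) := by
      have := ENNReal.Tendsto.mul_const (b := m A) (hpow (n + 1)) (Or.inl one_ne_zero)
      simpa only [pow_succ, one_mul] using this
    exact ge_of_tendsto hl (eventually_mem_nhdsWithin.mono fun c hc => (main c hc).1)
  · have hl : Tendsto (fun c : ℝ≥0 => ((c : ℝ≥0∞) ^ n * c ^ n * c) * ν A) (𝓝[>] 1)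
        (𝓝 (ν A)) := by
      have := ENNReal.Tendsto.mul_const (b := ν A) (hpow (n + n + 1)) (Or.inl one_ne_zero)
      simpa only [pow_succ, pow_add, one_mul] using this
    exact ge_of_tendsto hl (eventually_mem_nhdsWithin.mono fun c hc => (main c hc).2)

end ConeMonotonicity

/-! ### Pullback of forms and pushforward of currents under diffeomorphisms -/

namespace ConeMonotonicity

open Filter Topology Asymptotics
open scoped NNReal ENNReal

variable {N n : ℕ} {U : Set (Euc N)}

instance finiteDimensional_continuousMultilinearMap :
    FiniteDimensional ℝ (ContinuousMultilinearMap ℝ (fun _ : Fin n => Euc N) ℝ) :=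
  FiniteDimensional.of_injective
    (ContinuousMultilinearMap.toMultilinearMapLinear :
      ContinuousMultilinearMap ℝ (fun _ : Fin n => Euc N) ℝ →ₗ[ℝ] _)
    ContinuousMultilinearMap.toMultilinearMap_injective

/-- The pullback `F^* w` of a differential form. -/
noncomputable def pullback (F : Euc N → Euc N) (w : Form N n) : Form N n :=
  fun x => (w (F x)).compContinuousLinearMap (fderiv ℝ F x)

theorem contDiff_pullback {F : Euc N → Euc N} (hF : ContDiff ℝ ∞ F) {w : Form N n}
    (hw : ContDiff ℝ ∞ w) : ContDiff ℝ ∞ (pullback F w) := by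
  -- The pullback is smooth as a form with values in multilinear maps, and these project linearly
  -- onto the alternating maps.
  set tm : (Euc N) [⋀^Fin n]→L[ℝ] ℝ →L[ℝ] ContinuousMultilinearMap ℝ (fun _ : Fin n => Euc N) ℝ :=
    ContinuousAlternatingMap.toContinuousMultilinearMapCLM ℝ
  have htm : Function.Injective tm := ContinuousAlternatingMap.toContinuousMultilinearMap_injective
  obtain ⟨r, hr⟩ := tm.toLinearMap.exists_leftInverse_of_injective (LinearMap.ker_eq_bot.2 htm)
  have hsmooth : ContDiff ℝ ∞ fun x =>
      ContinuousMultilinearMap.compContinuousLinearMapContinuousMultilinear ℝ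
        (fun _ : Fin n => Euc N) (fun _ => Euc N) ℝ (fun _ => fderiv ℝ F x) (tm (w (F x))) := by
    refine ContDiff.clm_apply ?_ (tm.contDiff.comp (hw.comp hF))
    refine (ContinuousMultilinearMap.contDiff _).comp (contDiff_pi.2 fun _ => ?_)
    exact hF.fderiv_right (by simp)
  have := (LinearMap.toContinuousLinearMap r).contDiff.comp hsmooth
  convert this using 1
  ext1 x
  exact congr($hr (pullback F w x)).symm

theorem tsupport_pullback_subset (F : Euc N ≃ₜ Euc N) (w : Form N n) :
    tsupport (pullback F w) ⊆ F ⁻¹' tsupport w := by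
  refine closure_minimal (fun x hx => ?_) ((isClosed_tsupport w).preimage F.continuous)
  refine subset_tsupport _ fun h0 => hx ?_
  ext v
  simp [pullback, h0]

theorem IsTestForm.pullback {F : Euc N ≃ₜ Euc N} (hF : ContDiff ℝ ∞ F) {V : Set (Euc N)}
    {w : Form N n} (hw : IsTestForm V w) : IsTestForm (F ⁻¹' V) (pullback F w) where
  contDiff := contDiff_pullback hF hw.contDiff
  hasCompactSupport := by
    have : IsCompact (F ⁻¹' tsupport w) := F.isCompact_preimage.2 hw.hasCompactSupport
    exact this.of_isClosed_subset (isClosed_tsupport _) (tsupport_pullback_subset F w)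
  tsupport_subset := (tsupport_pullback_subset F w).trans (preimage_mono hw.tsupport_subset)

theorem IsTestForm.mono {V V' : Set (Euc N)} (h : V ⊆ V') {w : Form N n} (hw : IsTestForm V w) :
    IsTestForm V' w :=
  ⟨hw.contDiff, hw.hasCompactSupport, hw.tsupport_subset.trans h⟩

theorem injective_fderiv_homeomorph {F : Euc N ≃ₜ Euc N} (hF : ContDiff ℝ ∞ F)
    (hF' : ContDiff ℝ ∞ F.symm) (x : Euc N) : Function.Injective (fderiv ℝ F x) := by
  have h1 : HasFDerivAt F (fderiv ℝ F x) x := (hF.differentiable (by simp) x).hasFDerivAt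
  have h2 : HasFDerivAt F.symm (fderiv ℝ F.symm (F x)) (F x) :=
    (hF'.differentiable (by simp) _).hasFDerivAt
  have h21 : (fderiv ℝ F.symm (F x)).comp (fderiv ℝ F x) = ContinuousLinearMap.id ℝ _ := by
    refine (h2.comp x h1).unique ((hasFDerivAt_id _).congr_of_eventuallyEq ?_)
    exact Eventually.of_forall fun y => F.symm_apply_apply y
  exact Function.LeftInverse.injective (g := fderiv ℝ F.symm (F x)) fun v => congr($h21 v)

/-- A diffeomorphism `F` of `ℝᴺ` preserving `U`, together with a measurable choice `frame'` of
orthonormal frames for the images under `dF` of the tangent planes of the current `T`. The matrix of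
`dF` with respect to the frames of `T` and `frame'` is required to have positive determinant `J`, so
that `frame'` orients the pushforward of `T`. -/
structure FramedDiffeo (T : IntegerCurrent N n U) where
  /-- the diffeomorphism -/
  F : Euc N ≃ₜ Euc N
  contDiff : ContDiff ℝ ∞ F
  contDiff_symm : ContDiff ℝ ∞ F.symm
  /-- a Lipschitz constant of `F` -/
  K : ℝ≥0
  lipschitz : LipschitzWith K F
  mem_iff : ∀ x, F x ∈ U ↔ x ∈ U
  /-- the frame of the pushforward at `F x` -/
  frame' : Euc N → Fin n → Euc N
  measurable_frame' : Measurable frame'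
  orthonormal' : ∀ x, T.mult x ≠ 0 → Orthonormal ℝ (frame' x)
  /-- the Jacobian determinant of `F` along `T` -/
  J : Euc N → ℝ≥0
  measurable_J : Measurable J
  J_pos : ∀ x, T.mult x ≠ 0 → 0 < J x
  exists_linearMap : ∀ x, T.mult x ≠ 0 → ∃ L : Euc n →ₗ[ℝ] Euc n, LinearMap.det L = J x ∧
    (fderiv ℝ F x).toLinearMap ∘ₗ frameMap (T.frame x) = frameMap (frame' x) ∘ₗ L

namespace FramedDiffeo

variable {T : IntegerCurrent N n U} (G : FramedDiffeo T)

theorem measurableSet_carrier (T : IntegerCurrent N n U) : MeasurableSet {x | T.mult x ≠ 0} :=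
  T.measurable_mult (MeasurableSet.singleton 0).compl

/-- The determinant `J` is the volume factor of `dF` on the tangent plane of `T`. -/
theorem normDet_eq {x : Euc N} (hx : T.mult x ≠ 0) :
    (G.J x : ℝ) = ((fderiv ℝ G.F x).toLinearMap ∘ₗ frameMap (T.frame x)).normDet := by
  obtain ⟨L, hL, hLe⟩ := G.exists_linearMap x hx
  obtain ⟨ι, hι⟩ := exists_linearIsometry_eq_frameMap (G.orthonormal' x hx)
  rw [hLe, LinearMap.normDet_comp_of_finrank_eq _ _ rfl, ← hι, ι.normDet_eq_one, one_mul,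
    LinearMap.normDet_eq_abs_det, hL, NNReal.abs_eq]

theorem span_frame' {x : Euc N} (hx : T.mult x ≠ 0) :
    Submodule.span ℝ (range (G.frame' x)) =
      (Submodule.span ℝ (range (T.frame x))).map (fderiv ℝ G.F x : Euc N →ₗ[ℝ] Euc N) := by
  obtain ⟨L, hL, hLe⟩ := G.exists_linearMap x hx
  have hu : IsUnit (LinearMap.det L) := by
    rw [hL, isUnit_iff_ne_zero]
    exact_mod_cast (G.J_pos x hx).ne'
  have hLr : LinearMap.range L = ⊤ := by
    have := (LinearMap.equivOfIsUnitDet (M := Euc n) hu).range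
    rwa [show ((LinearMap.equivOfIsUnitDet hu : Euc n ≃ₗ[ℝ] Euc n) : Euc n →ₗ[ℝ] Euc n) = L
      from LinearMap.coe_equivOfIsUnitDet hu] at this
  rw [← range_frameMap, ← range_frameMap, ← LinearMap.range_comp]
  refine Eq.trans ?_ (congrArg LinearMap.range hLe).symm
  rw [LinearMap.range_comp, hLr, Submodule.map_top]

/-- `dF` maps the orienting `n`-vector of `T` to `J` times that of the pushforward. -/
theorem apply_fderiv_frame (w : (Euc N) [⋀^Fin n]→L[ℝ] ℝ) {x : Euc N} (hx : T.mult x ≠ 0) :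
    w (fun i => fderiv ℝ G.F x (T.frame x i)) = G.J x * w (G.frame' x) := by
  obtain ⟨L, hL, hLe⟩ := G.exists_linearMap x hx
  set b := (EuclideanSpace.basisFun (Fin n) ℝ).toBasis with hb
  have hbi : ∀ i, b i = EuclideanSpace.basisFun (Fin n) ℝ i := fun i => by
    rw [hb, OrthonormalBasis.coe_toBasis]
  set w' := w.toAlternatingMap.compLinearMap (frameMap (G.frame' x))
  have h1 := congr($(AlternatingMap.eq_smul_basis_det b w') (L ∘ b))
  rw [AlternatingMap.smul_apply, Module.Basis.det_comp, b.det_self, mul_one, hL, smul_eq_mul,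
    mul_comm] at h1
  have h2 : w' (L ∘ b) = w (fun i => fderiv ℝ G.F x (T.frame x i)) := by
    change w (fun i => frameMap (G.frame' x) (L (b i))) = _
    congr 1
    ext1 i
    have := congr($hLe (b i)).symm
    simp only [LinearMap.comp_apply] at this
    rw [this, hbi, frameMap_basis]
    rfl
  have h3 : w' b = w (G.frame' x) := by
    change w (fun i => frameMap (G.frame' x) (b i)) = _
    congr 1
    ext1 i
    rw [hbi, frameMap_basis]
  rw [← h2, h1, h3]

theorem map_symm_apply (A : Set (Euc N)) :
    (μHE[n].map G.F.symm : Measure (Euc N)) A = μHE[n] (G.F '' A) := by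
  rw [← G.F.symm.toMeasurableEquiv_coe, MeasurableEquiv.map_apply,
    G.F.symm.toMeasurableEquiv_coe, G.F.image_eq_preimage_symm]

theorem map_symm_le : (μHE[n].map G.F.symm : Measure (Euc N)) ≤ ((G.K : ℝ≥0∞) ^ n) • μHE[n] := by
  refine Measure.le_iff.2 fun A _ => ?_
  rw [map_symm_apply]
  exact G.lipschitz.lipschitzOnWith.euclideanHausdorffMeasure_image_le n

theorem measure_image_eq_zero {A : Set (Euc N)} (hA : μHE[n] A = 0) :
    μHE[n] (G.F '' A) = 0 := by
  have := G.map_symm_le A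
  rw [map_symm_apply, Measure.smul_apply, hA, smul_zero] at this
  exact le_antisymm this zero_le

theorem lintegral_comp_symm (g : Euc N → ℝ≥0∞) :
    ∫⁻ y, g (G.F.symm y) ∂μHE[n] = ∫⁻ x, g x ∂(μHE[n].map G.F.symm) :=
  (lintegral_map_equiv g G.F.symm.toMeasurableEquiv).symm

/-- On the carrier of the current, the pullback of the Hausdorff measure has density `J`. -/
theorem restrict_map_symm :
    (μHE[n].map G.F.symm : Measure (Euc N)).restrict {x | T.mult x ≠ 0} =
      (μHE[n].restrict {x | T.mult x ≠ 0}).withDensity fun x => (G.J x : ℝ≥0∞) := by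
  obtain ⟨S, hS1, hS2, hS3⟩ := T.rectifiable
  have hE := measurableSet_carrier T
  ext A hA
  rw [Measure.restrict_apply hA, map_symm_apply, withDensity_apply _ hA,
    Measure.restrict_restrict hA]
  exact measure_image_eq_lintegral (e := T.frame) ⟨hS1, hS2, hS3⟩ hE T.orthonormal G.F
    (G.contDiff.of_le (by simp)) (injective_fderiv_homeomorph G.contDiff G.contDiff_symm)
    G.lipschitz G.measurable_J G.J_pos (fun x hx => G.normDet_eq hx) (hA.inter hE)
    inter_subset_right

/-- The pushforward of an integer multiplicity current under a diffeomorphism. -/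
noncomputable def push : IntegerCurrent N n U where
  mult y := T.mult (G.F.symm y)
  frame y := G.frame' (G.F.symm y)
  measurable_mult := T.measurable_mult.comp G.F.symm.measurable
  measurable_frame := G.measurable_frame'.comp G.F.symm.measurable
  carrier_subset y hy := by
    rw [← G.F.apply_symm_apply y, G.mem_iff]
    exact T.carrier_subset _ hy
  orthonormal y hy := G.orthonormal' _ hy
  rectifiable := by
    obtain ⟨S, hS1, hS2, hS3⟩ := T.rectifiable
    have hF1 : ContDiff ℝ 1 G.F := G.contDiff.of_le (by simp)
    have hF1' : ContDiff ℝ 1 G.F.symm := G.contDiff_symm.of_le (by simp)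
    refine ⟨fun j => G.F '' S j, ?_, ?_, fun j => ?_⟩
    · rintro j _ ⟨x, hx, rfl⟩
      exact (hS1 j x hx).image_homeomorph G.F hF1 hF1'
    · refine measure_mono_null ?_ (G.measure_image_eq_zero hS2)
      rintro y ⟨hy, hyS⟩
      refine ⟨G.F.symm y, ⟨hy, fun h => hyS ?_⟩, G.F.apply_symm_apply y⟩
      obtain ⟨j, hj⟩ := mem_iUnion.1 h
      exact mem_iUnion.2 ⟨j, G.F.symm y, hj, G.F.apply_symm_apply y⟩
    · have h3 := G.measure_image_eq_zero (ae_iff.1 (hS3 j))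
      refine ae_iff.2 (measure_mono_null (fun y hy => ?_) h3)
      refine ⟨G.F.symm y, fun hx => hy fun hm hyS => ?_, G.F.apply_symm_apply y⟩
      obtain ⟨x, hxS, rfl⟩ := hyS
      rw [G.F.symm_apply_apply] at hm hx ⊢
      rw [tangentSpan_image_homeomorph G.F hF1 hF1', ← hx hm hxS, G.span_frame' hm]
  locally_finite K hK hKU := by
    have hK' : IsCompact (G.F ⁻¹' K) := G.F.isCompact_preimage.2 hK
    have hfin := T.locally_finite _ hK' fun x hx => (G.mem_iff x).1 (hKU hx)
    have hKm := hK.measurableSet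
    have hK'm := hK'.measurableSet
    rw [← lintegral_indicator hKm]
    have heq : ∀ y, K.indicator (fun y => ((T.mult (G.F.symm y)).natAbs : ℝ≥0∞)) y =
        (G.F ⁻¹' K).indicator (fun x => ((T.mult x).natAbs : ℝ≥0∞)) (G.F.symm y) := fun y => by
      by_cases hy : y ∈ K <;> simp [hy]
    simp_rw [heq]
    rw [G.lintegral_comp_symm]
    refine (lintegral_mono' G.map_symm_le le_rfl).trans_lt ?_
    rw [lintegral_smul_measure, lintegral_indicator hK'm]
    exact ENNReal.mul_lt_top (by finiteness) hfin

/-- The pushforward acts on forms by pulling them back. -/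
theorem eval_push (w : Form N n) : G.push.eval w = T.eval (pullback G.F w) := by
  have hE := measurableSet_carrier T
  set g : Euc N → ℝ := fun x => (T.mult x : ℝ) * w (G.F x) (G.frame' x) with hg
  have h1 : G.push.eval w = ∫ x, g x ∂(μHE[n].map G.F.symm) := by
    refine Eq.trans ?_ (integral_map_equiv G.F.symm.toMeasurableEquiv g).symm
    refine integral_congr_ae (Eventually.of_forall fun y => ?_)
    simp [hg, push]
  have h2 : ∀ x, x ∉ {x | T.mult x ≠ 0} → g x = 0 := fun x hx => by
    simp [hg, not_not.1 hx]
  have h3 : ∀ x, x ∉ {x | T.mult x ≠ 0} →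
      (T.mult x : ℝ) * pullback G.F w x (T.frame x) = 0 := fun x hx => by
    simp [not_not.1 hx]
  rw [h1, ← setIntegral_eq_integral_of_forall_compl_eq_zero h2, G.restrict_map_symm,
    integral_withDensity_eq_integral_smul G.measurable_J, IntegerCurrent.eval,
    ← setIntegral_eq_integral_of_forall_compl_eq_zero h3]
  refine setIntegral_congr_fun hE fun x hx => ?_
  have := G.apply_fderiv_frame (w (G.F x)) hx
  change G.J x * g x = T.mult x * w (G.F x) (fun i => fderiv ℝ G.F x (T.frame x i))
  rw [this, hg]
  ring

/-- The mass of the pushforward. -/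
theorem mass_push {W : Set (Euc N)} (hW : MeasurableSet W) :
    G.push.mass W = ∫⁻ x in G.F ⁻¹' W, G.J x ∂T.mass := by
  have hE := measurableSet_carrier T
  have hW' : MeasurableSet (G.F ⁻¹' W) := G.F.measurable hW
  have hm : Measurable fun x => ((T.mult x).natAbs : ℝ≥0∞) :=
    (Measurable.of_discrete (f := fun k : ℤ => ((k.natAbs : ℕ) : ℝ≥0∞))).comp T.measurable_mult
  set g : Euc N → ℝ≥0∞ := (G.F ⁻¹' W).indicator fun x => ((T.mult x).natAbs : ℝ≥0∞) with hg
  have hgm : Measurable g := hm.indicator hW'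
  have hgE : ∀ f : Euc N → ℝ≥0∞, {x | T.mult x ≠ 0}.indicator (fun x => f x * g x) =
      fun x => f x * g x := fun f => by
    refine indicator_eq_self.2 fun x hx h0 => hx ?_
    rw [hg]
    by_cases hxW : x ∈ G.F ⁻¹' W <;> simp [hxW, h0]
  have h1 : G.push.mass W = ∫⁻ x, g x ∂(μHE[n].map G.F.symm) := by
    rw [IntegerCurrent.mass, withDensity_apply _ hW, ← lintegral_indicator hW,
      ← G.lintegral_comp_symm]
    refine lintegral_congr fun y => ?_
    by_cases hy : y ∈ W <;> simp [hy, hg, push]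
  have h2 : ∫⁻ x in G.F ⁻¹' W, G.J x ∂T.mass = ∫⁻ x, G.J x * g x ∂μHE[n] := by
    rw [← lintegral_indicator hW', IntegerCurrent.mass, lintegral_withDensity_eq_lintegral_mul _ hm
      (G.measurable_J.coe_nnreal_ennreal.indicator hW')]
    refine lintegral_congr fun x => ?_
    by_cases hx : x ∈ G.F ⁻¹' W <;> simp [hx, hg, mul_comm]
  have h3 := hgE fun _ => 1
  simp only [one_mul] at h3
  rw [h1, h2, ← h3, ← hgE fun x => G.J x, lintegral_indicator hE, lintegral_indicator hE,
    G.restrict_map_symm,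
    lintegral_withDensity_eq_lintegral_mul _ G.measurable_J.coe_nnreal_ennreal hgm]
  rfl

/-- The pushforward of a cycle is a cycle, because the exterior derivative commutes with pullback. -/
theorem sameBoundary_push (hT : HasNoBoundary T) : SameBoundary G.push T := by
  cases n with
  | zero => trivial
  | succ n =>
    intro η hη
    have hη' : IsTestForm U (pullback G.F η) :=
      (hη.pullback G.contDiff).mono fun x hx => (G.mem_iff x).1 hx
    have hd : pullback G.F (extDeriv η) = extDeriv (pullback G.F η) := by
      ext1 x
      exact (extDeriv_pullback (r := ∞) (hη.contDiff.differentiable (by simp) _)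
        G.contDiff.contDiffAt (by simpa using ENat.LEInfty.out)).symm
    rw [G.eval_push, hd, hT _ hη', hT _ hη]

end FramedDiffeo

end ConeMonotonicity

/-! ### Radial diffeomorphisms and their action on frames -/

namespace ConeMonotonicity

open Filter Topology Asymptotics
open scoped NNReal ENNReal InnerProductSpace

variable {N n : ℕ} {U : Set (Euc N)}

/-- The radial map `x ↦ exp (h (|x|²)) x`. -/
noncomputable def radialMap (N : ℕ) (h : ℝ → ℝ) (x : Euc N) : Euc N := Real.exp (h (‖x‖ ^ 2)) • x

/-- Smooth functions `h` vanishing on `[R², ∞)` that are so small that the radial map of `h` is a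
diffeomorphism: by the two bounds it differs from the identity by a map with Lipschitz constant
`1/2`. -/
structure IsSmallProfile (R : ℝ) (h : ℝ → ℝ) : Prop where
  contDiff : ContDiff ℝ ∞ h
  eq_zero : ∀ u, R ^ 2 ≤ u → h u = 0
  abs_apply_le : ∀ u, 0 ≤ u → |h u| ≤ 1 / 8
  abs_deriv_le : ∀ u, 0 ≤ u → |deriv h u| * u ≤ 1 / 16

theorem contDiff_radialMap {h : ℝ → ℝ} (hh : ContDiff ℝ ∞ h) : ContDiff ℝ ∞ (radialMap N h) :=
  (Real.contDiff_exp.comp (hh.comp (contDiff_norm_sq ℝ))).smul contDiff_id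

theorem hasFDerivAt_radialMap {h : ℝ → ℝ} (hh : ContDiff ℝ ∞ h) (x : Euc N) :
    HasFDerivAt (radialMap N h) (Real.exp (h (‖x‖ ^ 2)) • (ContinuousLinearMap.id ℝ (Euc N) +
      (2 * deriv h (‖x‖ ^ 2)) • (innerSL ℝ x).smulRight x)) x := by
  have h1 : HasFDerivAt (fun y : Euc N => ‖y‖ ^ 2) (2 • innerSL ℝ x) x :=
    (hasStrictFDerivAt_norm_sq x).hasFDerivAt
  have h2 : HasDerivAt h (deriv h (‖x‖ ^ 2)) (‖x‖ ^ 2) :=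
    (hh.differentiable (by simp) _).hasDerivAt
  have h3 := (h2.exp.comp_hasFDerivAt x h1).smul (hasFDerivAt_id x)
  refine h3.congr_fderiv ?_
  ext1 v
  simp [smul_smul]
  ring_nf

namespace IsSmallProfile

variable {R : ℝ} {h : ℝ → ℝ} (hh : IsSmallProfile R h)
include hh

theorem radialMap_eq_self (hR : 0 ≤ R) {x : Euc N} (hx : R ≤ ‖x‖) : radialMap N h x = x := by
  rw [radialMap, hh.eq_zero _ (by gcongr), Real.exp_zero, one_smul]

theorem lipschitzWith_radialMap_sub :
    LipschitzWith (1 / 2) (fun x : Euc N => radialMap N h x - x) := by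
  have hd : ∀ x : Euc N, HasFDerivAt (fun x : Euc N => radialMap N h x - x)
      (Real.exp (h (‖x‖ ^ 2)) • (ContinuousLinearMap.id ℝ (Euc N) +
      (2 * deriv h (‖x‖ ^ 2)) • (innerSL ℝ x).smulRight x) - ContinuousLinearMap.id ℝ (Euc N)) x :=
    fun x => (hasFDerivAt_radialMap hh.contDiff x).sub (hasFDerivAt_id x)
  refine lipschitzWith_of_nnnorm_fderiv_le (𝕜 := ℝ) (fun x => (hd x).differentiableAt) fun x => ?_
  rw [(hd x).fderiv, ← NNReal.coe_le_coe, coe_nnnorm]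
  refine ContinuousLinearMap.opNorm_le_bound _ (by positivity) fun v => ?_
  have h1 := hh.abs_apply_le (‖x‖ ^ 2) (by positivity)
  have h2 := hh.abs_deriv_le (‖x‖ ^ 2) (by positivity)
  set k := h (‖x‖ ^ 2)
  set k' := deriv h (‖x‖ ^ 2)
  have h3 : |Real.exp k - 1| ≤ 1 / 4 := by
    have := Real.abs_exp_sub_one_le (x := k) (by linarith)
    linarith
  have h4 : Real.exp k ≤ 5 / 4 := by linarith [(abs_le.1 h3).2]
  have h5 : |⟪x, v⟫_ℝ| ≤ ‖x‖ * ‖v‖ := abs_real_inner_le_norm x v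
  have heq : (Real.exp k • (ContinuousLinearMap.id ℝ (Euc N) +
      (2 * k') • (innerSL ℝ x).smulRight x) - ContinuousLinearMap.id ℝ (Euc N)) v =
      (Real.exp k - 1) • v + (Real.exp k * (2 * k') * ⟪x, v⟫_ℝ) • x := by
    simp only [sub_apply, smul_apply, add_apply, ContinuousLinearMap.smulRight_apply,
      ContinuousLinearMap.id_apply, innerSL_apply_apply]
    module
  rw [heq]
  calc ‖(Real.exp k - 1) • v + (Real.exp k * (2 * k') * ⟪x, v⟫_ℝ) • x‖
      ≤ |Real.exp k - 1| * ‖v‖ + Real.exp k * (2 * |k'|) * |⟪x, v⟫_ℝ| * ‖x‖ := by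
        refine (norm_add_le _ _).trans_eq ?_
        rw [norm_smul, norm_smul, Real.norm_eq_abs, Real.norm_eq_abs, abs_mul, abs_mul, abs_mul,
          Real.abs_exp, abs_two]
    _ ≤ 1 / 4 * ‖v‖ + 5 / 4 * (2 * |k'|) * (‖x‖ * ‖v‖) * ‖x‖ := by gcongr
    _ = 1 / 4 * ‖v‖ + 5 / 2 * (|k'| * ‖x‖ ^ 2) * ‖v‖ := by ring
    _ ≤ 1 / 4 * ‖v‖ + 5 / 2 * (1 / 16) * ‖v‖ := by gcongr
    _ ≤ ((1 / 2 : ℝ≥0) : ℝ) * ‖v‖ := by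
        push_cast
        nlinarith [norm_nonneg v]

theorem approximatesLinearOn_radialMap : ApproximatesLinearOn (radialMap N h)
    (ContinuousLinearEquiv.refl ℝ (Euc N) : Euc N →L[ℝ] Euc N) univ (1 / 2) := by
  intro x _ y _
  have := hh.lipschitzWith_radialMap_sub.dist_le_mul x y
  rw [dist_eq_norm, dist_eq_norm] at this
  refine le_trans (le_of_eq (congrArg norm ?_)) this
  simp only [ContinuousLinearEquiv.coe_coe, ContinuousLinearEquiv.refl_apply]
  abel

omit hh in
theorem subsingleton_or_half_lt (N : ℕ) : Subsingleton (Euc N) ∨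
    (1 / 2 : ℝ≥0) < ‖((ContinuousLinearEquiv.refl ℝ (Euc N)).symm : Euc N →L[ℝ] Euc N)‖₊⁻¹ := by
  rcases subsingleton_or_nontrivial (Euc N) with hs | hs
  · exact Or.inl hs
  · refine Or.inr ?_
    have : ‖((ContinuousLinearEquiv.refl ℝ (Euc N)).symm : Euc N →L[ℝ] Euc N)‖₊ = 1 := by
      rw [← NNReal.coe_inj, coe_nnnorm]
      exact ContinuousLinearMap.norm_id
    rw [this, inv_one]
    exact NNReal.half_lt_self one_ne_zero

/-- The radial map of a small profile as a homeomorphism of `ℝᴺ`. -/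
noncomputable def radialHomeomorph (N : ℕ) : Euc N ≃ₜ Euc N :=
  hh.approximatesLinearOn_radialMap.toHomeomorph _ (subsingleton_or_half_lt N)

theorem coe_radialHomeomorph : ⇑(hh.radialHomeomorph N) = radialMap N h := rfl

theorem contDiff_radialHomeomorph_symm : ContDiff ℝ ∞ (hh.radialHomeomorph N).symm := by
  have hd : ∀ x, ∃ D : Euc N ≃L[ℝ] Euc N,
      HasFDerivAt (hh.radialHomeomorph N) (D : Euc N →L[ℝ] Euc N) x := by
    intro x
    have hdx : HasFDerivAt (radialMap N h) (fderiv ℝ (radialMap N h) x) x :=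
      ((contDiff_radialMap hh.contDiff).differentiable (by simp) x).hasFDerivAt
    -- The derivative is within distance `1/2` of the identity, hence injective.
    have h1 : ‖fderiv ℝ (radialMap N h) x - ContinuousLinearMap.id ℝ (Euc N)‖ ≤ 1 / 2 := by
      have := norm_fderiv_le_of_lipschitz ℝ (x₀ := x) hh.lipschitzWith_radialMap_sub
      have heq : fderiv ℝ (fun x => radialMap N h x - x) x =
          fderiv ℝ (radialMap N h) x - ContinuousLinearMap.id ℝ (Euc N) :=
        (hdx.sub (hasFDerivAt_id x)).fderiv
      rw [heq] at this
      simpa using this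
    have hinj : Function.Injective (fderiv ℝ (radialMap N h) x) := by
      refine (injective_iff_map_eq_zero _).2 fun v hv => ?_
      have h2 := (fderiv ℝ (radialMap N h) x - ContinuousLinearMap.id ℝ (Euc N)).le_of_opNorm_le
        h1 v
      simp only [sub_apply, hv, ContinuousLinearMap.id_apply, zero_sub, norm_neg] at h2
      exact norm_le_zero_iff.1 (by linarith)
    refine ⟨(LinearEquiv.ofInjectiveEndo (fderiv ℝ (radialMap N h) x).toLinearMap
      hinj).toContinuousLinearEquiv, ?_⟩
    exact hdx
  choose D hD using hd
  exact (hh.radialHomeomorph N).contDiff_symm hD (contDiff_radialMap hh.contDiff)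

theorem norm_radialMap_lt_iff (hR : 0 ≤ R) (x : Euc N) : ‖radialMap N h x‖ < R ↔ ‖x‖ < R := by
  have hinj : Function.Injective (radialMap N h) := (hh.radialHomeomorph N).injective
  constructor
  · intro hx
    by_contra hcon
    rw [hh.radialMap_eq_self hR (not_lt.1 hcon)] at hx
    exact hcon hx
  · intro hx
    by_contra hcon
    have := hinj (hh.radialMap_eq_self hR (not_lt.1 hcon))
    rw [this] at hcon
    exact hcon hx

theorem radialMap_mem_iff (hR : 0 ≤ R) (hU : ball 0 R ⊆ U) (x : Euc N) :
    radialMap N h x ∈ U ↔ x ∈ U := by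
  rcases lt_or_ge ‖x‖ R with hx | hx
  · have h1 := (hh.norm_radialMap_lt_iff hR x).2 hx
    exact iff_of_true (hU (by simpa using h1)) (hU (by simpa using hx))
  · rw [hh.radialMap_eq_self hR hx]

theorem lipschitzWith_radialMap : LipschitzWith (1 / 2 + 1) (radialMap N h) := by
  simpa using hh.lipschitzWith_radialMap_sub.add LipschitzWith.id

end IsSmallProfile

/-- The squared length `Σ ⟨x, eᵢ⟩²` of the orthogonal projection of `x` to the span of the
orthonormal vectors `eᵢ`. -/
noncomputable def tangentialSq (x : Euc N) (e : Fin n → Euc N) : ℝ := ∑ i, ⟪x, e i⟫_ℝ ^ 2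

/-- `det (I + κ a aᵀ)^{1/2}` with `aᵢ = ⟨x, eᵢ⟩` and `κ = 2β + β²|x|²`: the Jacobian on the span of
the orthonormal vectors `eᵢ` of the linear map `v ↦ v + β⟨x, v⟩x`. -/
noncomputable def shearJacobian (β : ℝ) (x : Euc N) (e : Fin n → Euc N) : ℝ :=
  √(1 + (2 * β + β ^ 2 * ‖x‖ ^ 2) * tangentialSq x e)

/-- The symmetric orthonormalization (multiplication by the inverse square root of the Gram matrix)
of the images of the orthonormal vectors `eᵢ` under `v ↦ v + β⟨x, v⟩x`. -/
noncomputable def shearFrame (β : ℝ) (x : Euc N) (e : Fin n → Euc N) (i : Fin n) : Euc N :=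
  e i + ⟪x, e i⟫_ℝ •
    ((-(2 * β + β ^ 2 * ‖x‖ ^ 2) / (shearJacobian β x e * (1 + shearJacobian β x e))) •
      (∑ k, ⟪x, e k⟫_ℝ • e k) + (β / shearJacobian β x e) • x)

theorem tangentialSq_nonneg (x : Euc N) (e : Fin n → Euc N) : 0 ≤ tangentialSq x e :=
  Finset.sum_nonneg fun _ _ => sq_nonneg _

theorem tangentialSq_le {e : Fin n → Euc N} (he : Orthonormal ℝ e) (x : Euc N) :
    tangentialSq x e ≤ ‖x‖ ^ 2 := by
  have := he.sum_inner_products_le (s := Finset.univ) x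
  simpa [tangentialSq, real_inner_comm] using this

section Shear

variable {β : ℝ} {x : Euc N} {e : Fin n → Euc N}

theorem shearJacobian_radicand_pos (he : Orthonormal ℝ e) (hβ : |β| * ‖x‖ ^ 2 ≤ 1 / 2) :
    0 < 1 + (2 * β + β ^ 2 * ‖x‖ ^ 2) * tangentialSq x e := by
  have h1 := tangentialSq_le he x
  have h2 := tangentialSq_nonneg x e
  have h3 : |β| * tangentialSq x e ≤ 1 / 2 := le_trans (by gcongr) hβ
  have h4 : -(1 / 2) ≤ β * tangentialSq x e := by
    have := neg_abs_le (β * tangentialSq x e)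
    rw [abs_mul, abs_of_nonneg h2] at this
    linarith
  have h5 : β ^ 2 * tangentialSq x e * tangentialSq x e ≤ β ^ 2 * ‖x‖ ^ 2 * tangentialSq x e := by
    rw [mul_assoc, mul_assoc]
    gcongr
  nlinarith [sq_nonneg (1 + β * tangentialSq x e)]

theorem shearJacobian_pos (he : Orthonormal ℝ e) (hβ : |β| * ‖x‖ ^ 2 ≤ 1 / 2) :
    0 < shearJacobian β x e :=
  Real.sqrt_pos.2 (shearJacobian_radicand_pos he hβ)

theorem shearJacobian_sq (he : Orthonormal ℝ e) (hβ : |β| * ‖x‖ ^ 2 ≤ 1 / 2) :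
    shearJacobian β x e ^ 2 = 1 + (2 * β + β ^ 2 * ‖x‖ ^ 2) * tangentialSq x e :=
  Real.sq_sqrt (shearJacobian_radicand_pos he hβ).le

/-- An upper bound for the Jacobian, exact to first order in `β`. -/
theorem shearJacobian_le_exp (β : ℝ) (x : Euc N) (e : Fin n → Euc N) :
    shearJacobian β x e ≤
      Real.exp (β * tangentialSq x e + β ^ 2 * ‖x‖ ^ 2 * tangentialSq x e / 2) := by
  refine Real.sqrt_le_iff.2 ⟨(Real.exp_pos _).le, ?_⟩
  rw [← Real.exp_nat_mul]
  have := Real.add_one_le_exp ((2 * β + β ^ 2 * ‖x‖ ^ 2) * tangentialSq x e)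
  refine le_trans (by linarith) (this.trans_eq ?_)
  congr 1
  push_cast
  ring

theorem orthonormal_shearFrame (he : Orthonormal ℝ e) (hβ : |β| * ‖x‖ ^ 2 ≤ 1 / 2) :
    Orthonormal ℝ (shearFrame β x e) := by
  have hs := shearJacobian_pos he hβ
  have hs2 := shearJacobian_sq he hβ
  set s := shearJacobian β x e with hsdef
  set p := tangentialSq x e with hp
  set y := ∑ k, ⟪x, e k⟫_ℝ • e k with hy
  set κ := 2 * β + β ^ 2 * ‖x‖ ^ 2 with hκ
  set z := (-κ / (s * (1 + s))) • y + (β / s) • x with hz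
  have hey : ∀ i, ⟪e i, y⟫_ℝ = ⟪x, e i⟫_ℝ := fun i => he.inner_right_fintype _ i
  have hxy : ⟪x, y⟫_ℝ = p := by
    rw [hy, inner_sum, hp, tangentialSq]
    exact Finset.sum_congr rfl fun i _ => by rw [inner_smul_right]; ring
  have hyy : ⟪y, y⟫_ℝ = p := by
    conv_lhs => rw [hy, sum_inner]
    rw [hp, tangentialSq]
    refine Finset.sum_congr rfl fun i _ => ?_
    rw [inner_smul_left, hey]
    simp [sq]
  have hxx : ⟪x, x⟫_ℝ = ‖x‖ ^ 2 := real_inner_self_eq_norm_sq x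
  have hez : ∀ i, ⟪e i, z⟫_ℝ = ⟪x, e i⟫_ℝ * (-κ / (s * (1 + s)) + β / s) := fun i => by
    rw [hz, inner_add_right, inner_smul_right, inner_smul_right, hey, real_inner_comm (e i) x]
    ring
  have hzz : ⟪z, z⟫_ℝ = -2 * (-κ / (s * (1 + s)) + β / s) := by
    rw [hz, inner_add_left, inner_add_right, inner_add_right, inner_smul_left, inner_smul_left,
      inner_smul_left, inner_smul_left, inner_smul_right, inner_smul_right, inner_smul_right,
      inner_smul_right, real_inner_comm x y, hxy, hyy, hxx]
    simp only [conj_trivial]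
    have h1 : (1 : ℝ) + s ≠ 0 := by positivity
    field_simp
    have h2 : κ * p = s ^ 2 - 1 := by linarith
    have h3 : β ^ 2 * ‖x‖ ^ 2 = κ - 2 * β := by rw [hκ]; ring
    linear_combination (κ - 2 * β * (1 + s)) * h2 + (1 + s) ^ 2 * h3
  rw [orthonormal_iff_ite] at he ⊢
  intro i j
  have hexp : ∀ i, shearFrame β x e i = e i + ⟪x, e i⟫_ℝ • z := fun i => rfl
  rw [hexp, hexp, inner_add_left, inner_add_right, inner_add_right, he i j, inner_smul_left,
    inner_smul_left, inner_smul_right, inner_smul_right, hez, real_inner_comm (e j) z, hez, hzz]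
  simp only [conj_trivial]
  ring

/-- With respect to the frames `e` and `shearFrame β x e`, the map `v ↦ v + β⟨x, v⟩x` is given by
`I + σ a aᵀ`, where `aᵢ = ⟨x, eᵢ⟩`, with determinant `shearJacobian β x e`. -/
theorem exists_linearMap_shearFrame (he : Orthonormal ℝ e) (hβ : |β| * ‖x‖ ^ 2 ≤ 1 / 2) :
    ∃ L : Euc n →ₗ[ℝ] Euc n, LinearMap.det L = shearJacobian β x e ∧
      (ContinuousLinearMap.id ℝ (Euc N) + β • (innerSL ℝ x).smulRight x).toLinearMap ∘ₗ
        frameMap e = frameMap (shearFrame β x e) ∘ₗ L := by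
  have hs := shearJacobian_pos he hβ
  have hs2 := shearJacobian_sq he hβ
  have hshear : ∀ i, shearFrame β x e i = e i + ⟪x, e i⟫_ℝ •
    ((-(2 * β + β ^ 2 * ‖x‖ ^ 2) / (shearJacobian β x e * (1 + shearJacobian β x e))) •
      (∑ k, ⟪x, e k⟫_ℝ • e k) + (β / shearJacobian β x e) • x) := fun i => rfl
  set s := shearJacobian β x e with hsdef
  set p := tangentialSq x e with hp
  set y := ∑ k, ⟪x, e k⟫_ℝ • e k with hy
  set κ := 2 * β + β ^ 2 * ‖x‖ ^ 2 with hκ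
  set z := (-κ / (s * (1 + s))) • y + (β / s) • x with hz
  set b := EuclideanSpace.basisFun (Fin n) ℝ with hb
  set a : Euc n := ∑ k, ⟪x, e k⟫_ℝ • b k with ha
  have hba : ∀ i, ⟪a, b i⟫_ℝ = ⟪x, e i⟫_ℝ := fun i => by
    rw [real_inner_comm]; exact b.orthonormal.inner_right_fintype _ i
  have haa : ⟪a, a⟫_ℝ = p := by
    conv_lhs => enter [2]; rw [ha]
    rw [inner_sum, hp, tangentialSq]
    refine Finset.sum_congr rfl fun i _ => ?_
    rw [inner_smul_right, hba, sq]
  have h1 : (1 : ℝ) + s ≠ 0 := by positivity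
  have h2 : κ * p = s ^ 2 - 1 := by linarith
  -- Here `σ = κ / (1 + s)`, so the determinant `1 + σ |a|²` is `1 + (s² - 1) / (1 + s) = s`.
  refine ⟨LinearMap.transvection ((κ / (1 + s)) • (innerSL ℝ a).toLinearMap) a, ?_, ?_⟩
  · rw [LinearMap.transvection.det]
    have : ((κ / (1 + s)) • (innerSL ℝ a).toLinearMap) a = κ / (1 + s) * p := by
      rw [← haa]; rfl
    rw [this]
    field_simp
    linarith
  · refine b.toBasis.ext fun i => ?_
    rw [OrthonormalBasis.coe_toBasis, LinearMap.comp_apply, LinearMap.comp_apply, frameMap_basis,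
      LinearMap.transvection.apply]
    have h3 : ((κ / (1 + s)) • (innerSL ℝ a).toLinearMap) (b i) = κ / (1 + s) * ⟪x, e i⟫_ℝ := by
      rw [← hba]; rfl
    have h4 : frameMap (shearFrame β x e) a = y + p • z := by
      rw [ha, map_sum]
      simp only [map_smul, hb, frameMap_basis, hshear, smul_add, Finset.sum_add_distrib, smul_smul,
        ← Finset.sum_smul, ← sq]
      rfl
    rw [h3, map_add, map_smul, h4, frameMap_basis, hshear]
    have h5 : (ContinuousLinearMap.id ℝ (Euc N) + β • (innerSL ℝ x).smulRight x).toLinearMap (e i)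
        = e i + (β * ⟪x, e i⟫_ℝ) • x := by
      simp [smul_smul]
    rw [h5, hz]
    have h6 : (1 + κ / (1 + s) * p) * (β / s) = β := by
      field_simp
      linear_combination β * h2
    have h7 : (1 + κ / (1 + s) * p) * (-κ / (s * (1 + s))) + κ / (1 + s) = 0 := by
      field_simp
      linear_combination -κ * h2
    have h8 : ∀ c d w : ℝ, e i + w • (c • y + d • x) + (κ / (1 + s) * w) •
        (y + p • (c • y + d • x)) = e i + w • (((1 + κ / (1 + s) * p) * c + κ / (1 + s)) • y +
          ((1 + κ / (1 + s) * p) * d) • x) := fun c d w => by module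
    rw [h8, h6, h7, zero_smul, zero_add, smul_smul, mul_comm]

end Shear

/-- The diffeomorphism `x ↦ exp (h (|x|²)) x` together with the frames of the pushforward of `T`. -/
noncomputable def IsSmallProfile.framedDiffeo {R : ℝ} {h : ℝ → ℝ} (hh : IsSmallProfile R h)
    (hR : 0 ≤ R) (T : IntegerCurrent N n U) (hU : ball 0 R ⊆ U) : FramedDiffeo T where
  F := hh.radialHomeomorph N
  contDiff := contDiff_radialMap hh.contDiff
  contDiff_symm := hh.contDiff_radialHomeomorph_symm
  K := 1 / 2 + 1
  lipschitz := hh.lipschitzWith_radialMap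
  mem_iff := hh.radialMap_mem_iff hR hU
  frame' x := shearFrame (2 * deriv h (‖x‖ ^ 2)) x (T.frame x)
  measurable_frame' := by
    have hd : Measurable (deriv h) := measurable_deriv h
    have he : ∀ i, Measurable fun x => T.frame x i := fun i =>
      (measurable_pi_apply i).comp T.measurable_frame
    refine measurable_pi_iff.2 fun i => ?_
    unfold shearFrame shearJacobian tangentialSq
    fun_prop
  orthonormal' x hx := orthonormal_shearFrame (T.orthonormal x hx) (by
    have := hh.abs_deriv_le (‖x‖ ^ 2) (by positivity)
    rw [abs_mul, abs_two]
    linarith)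
  J x := Real.toNNReal (Real.exp (n * h (‖x‖ ^ 2)) *
    shearJacobian (2 * deriv h (‖x‖ ^ 2)) x (T.frame x))
  measurable_J := by
    have hd : Measurable (deriv h) := measurable_deriv h
    have hm : Measurable h := hh.contDiff.continuous.measurable
    have he : ∀ i, Measurable fun x => T.frame x i := fun i =>
      (measurable_pi_apply i).comp T.measurable_frame
    unfold shearJacobian tangentialSq
    fun_prop
  J_pos x hx := by
    have := hh.abs_deriv_le (‖x‖ ^ 2) (by positivity)
    exact Real.toNNReal_pos.2 (mul_pos (Real.exp_pos _)
      (shearJacobian_pos (T.orthonormal x hx) (by rw [abs_mul, abs_two]; linarith)))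
  exists_linearMap x hx := by
    have := hh.abs_deriv_le (‖x‖ ^ 2) (by positivity)
    have hβ : |2 * deriv h (‖x‖ ^ 2)| * ‖x‖ ^ 2 ≤ 1 / 2 := by rw [abs_mul, abs_two]; linarith
    obtain ⟨L, hL, hLe⟩ := exists_linearMap_shearFrame (T.orthonormal x hx) hβ
    refine ⟨Real.exp (h (‖x‖ ^ 2)) • L, ?_, ?_⟩
    · rw [LinearMap.det_smul, finrank_euclideanSpace_fin, hL, Real.coe_toNNReal, ← Real.exp_nat_mul]
      exact mul_nonneg (Real.exp_pos _).le (Real.sqrt_nonneg _)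
    · rw [hh.coe_radialHomeomorph, (hasFDerivAt_radialMap hh.contDiff x).fderiv,
        LinearMap.comp_smul, ← hLe]
      rfl

end ConeMonotonicity

/-! ### Supports of functionals on forms -/

namespace ConeMonotonicity

open Filter Topology Asymptotics
open scoped NNReal ENNReal InnerProductSpace

variable {N n : ℕ} {U : Set (Euc N)}

/-- The support is closed relative to `U`, hence compact if it lies in a compact subset of `U`. -/
theorem isCompact_supportIn_of_subset {Λ : Form N n → ℝ} {K : Set (Euc N)} (hK : IsCompact K)
    (hKU : K ⊆ U) (h : supportIn U Λ ⊆ K) : IsCompact (supportIn U Λ) := by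
  set Z : Set (Euc N) := {x | ∀ V : Set (Euc N), IsOpen V → V ⊆ U → x ∈ V →
    ∃ w : Form N n, IsTestForm V w ∧ Λ w ≠ 0} with hZ
  have hZc : IsClosed Z := by
    refine isOpen_compl_iff.1 (isOpen_iff_mem_nhds.2 fun x hx => ?_)
    simp only [hZ, mem_compl_iff, mem_ofPred_eq, not_forall, exists_prop] at hx
    obtain ⟨V, hV, hVU, hxV, hw⟩ := hx
    exact mem_of_superset (hV.mem_nhds hxV) fun y hy hyZ => hw (hyZ V hV hVU hy)
  have heq : supportIn U Λ = K ∩ Z :=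
    Subset.antisymm (fun x hx => ⟨h hx, hx.2⟩) fun x hx => ⟨hKU hx.1, hx.2⟩
  rw [heq]
  exact hK.inter_right hZc

theorem exists_nhds_eq_zero_of_notMem_supportIn {Λ : Form N n → ℝ} {x : Euc N} (hxU : x ∈ U)
    (hx : x ∉ supportIn U Λ) : ∃ V : Set (Euc N), IsOpen V ∧ V ⊆ U ∧ x ∈ V ∧
      ∀ w : Form N n, IsTestForm V w → Λ w = 0 := by
  by_contra hcon
  push Not at hcon
  exact hx ⟨hxU, fun V hV hVU hxV => hcon V hV hVU hxV⟩

theorem IsTestForm.eq_zero {V : Set (Euc N)} {w : Form N n} (hw : IsTestForm V w) {x : Euc N}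
    (hx : x ∉ V) : w x = 0 :=
  image_eq_zero_of_notMem_tsupport fun h => hx (hw.tsupport_subset h)

namespace FramedDiffeo

variable {T : IntegerCurrent N n U} (G : FramedDiffeo T)

/-- A diffeomorphism changes a current only where it differs from the identity. -/
theorem supportIn_push_sub_subset_closedBall (hU : IsOpen U) {R : ℝ}
    (hfix : ∀ x, R ≤ ‖x‖ → G.F x = x) :
    (supportIn U fun w => G.push.eval w - T.eval w) ⊆ closedBall 0 R := by
  intro x hx
  by_contra hxR
  obtain ⟨w, hw, hne⟩ := hx.2 (U ∩ (closedBall 0 R)ᶜ)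
    (hU.inter isClosed_closedBall.isOpen_compl) inter_subset_left ⟨hx.1, hxR⟩
  refine hne ?_
  have : pullback G.F w = w := by
    ext1 y
    rcases le_or_gt ‖y‖ R with hy | hy
    · have hFy : ‖G.F y‖ ≤ R := by
        by_contra hcon
        have := G.F.injective (hfix _ (not_le.1 hcon).le)
        rw [this] at hcon
        exact hcon hy
      rw [pullback, hw.eq_zero fun h => h.2 (by simpa using hFy),
        hw.eq_zero fun h => h.2 (by simpa using hy)]
      rfl
    · have hev : G.F =ᶠ[𝓝 y] id := by
        filter_upwards [(isOpen_lt continuous_const continuous_norm).mem_nhds hy] with z hz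
        exact hfix z (le_of_lt hz)
      rw [pullback, hev.fderiv_eq, hev.eq_of_nhds, fderiv_id]
      rfl
  change G.push.eval w - T.eval w = 0
  rw [G.eval_push, this, sub_self]

/-- A diffeomorphism preserving `C` maps currents supported in `C` to currents supported in `C`. -/
theorem supportIn_push_sub_subset {C : Set (Euc N)} (hTC : supportIn U T.eval ⊆ C)
    (hC : ∀ x, G.F x ∈ C ↔ x ∈ C) :
    (supportIn U fun w => G.push.eval w - T.eval w) ⊆ C := by
  intro x hx
  by_contra hxC
  set x' := G.F.symm x
  have hFx' : G.F x' = x := G.F.apply_symm_apply x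
  have hx'U : x' ∈ U := (G.mem_iff x').1 (hFx' ▸ hx.1)
  have hx'C : x' ∉ C := fun h => hxC (hFx' ▸ (hC x').2 h)
  obtain ⟨V, hV, hVU, hxV, hVw⟩ :=
    exists_nhds_eq_zero_of_notMem_supportIn hx.1 fun h => hxC (hTC h)
  obtain ⟨V', hV', -, hxV', hVw'⟩ :=
    exists_nhds_eq_zero_of_notMem_supportIn hx'U fun h => hx'C (hTC h)
  obtain ⟨w, hw, hne⟩ := hx.2 (V ∩ G.F.symm ⁻¹' V') (hV.inter (hV'.preimage G.F.symm.continuous))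
    (inter_subset_left.trans hVU) ⟨hxV, hxV'⟩
  refine hne ?_
  change G.push.eval w - T.eval w = 0
  rw [G.eval_push, hVw w (hw.mono inter_subset_left),
    hVw' _ ((hw.pullback G.contDiff).mono fun y hy => ?_), sub_zero]
  simpa using hy.2

end FramedDiffeo

/-! ### The first variation along radial vector fields -/

theorem ae_mult_ne_zero (T : IntegerCurrent N n U) : ∀ᵐ x ∂T.mass, T.mult x ≠ 0 := by
  have hm : Measurable fun x => ((T.mult x).natAbs : ℝ≥0∞) :=
    (Measurable.of_discrete (f := fun k : ℤ => ((k.natAbs : ℕ) : ℝ≥0∞))).comp T.measurable_mult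
  rw [IntegerCurrent.mass, ae_withDensity_iff hm]
  filter_upwards with x hx h0
  simp [h0] at hx

theorem mass_lt_top (T : IntegerCurrent N n U) {K : Set (Euc N)} (hK : IsCompact K) (hKU : K ⊆ U) :
    T.mass K < ⊤ := by
  rw [IntegerCurrent.mass, withDensity_apply _ hK.measurableSet]
  exact T.locally_finite K hK hKU

theorem measurable_tangentialSq (T : IntegerCurrent N n U) :
    Measurable fun x => tangentialSq x (T.frame x) := by
  have he : ∀ i, Measurable fun x => T.frame x i := fun i =>
    (measurable_pi_apply i).comp T.measurable_frame
  unfold tangentialSq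
  fun_prop

theorem IsMetricCone.smul_mem_iff {C : Set (Euc N)} (hC : IsMetricCone n C) {c : ℝ} (hc : 0 < c)
    (x : Euc N) : c • x ∈ C ↔ x ∈ C := by
  have h1 : ∀ c : ℝ, 0 < c → ∀ x ∈ C, c • x ∈ C := fun c hc x hx => by
    rw [← hC.dilation_invariant c⁻¹ (inv_pos.2 hc)]
    exact ⟨x, hx, by simp⟩
  refine ⟨fun h => ?_, h1 c hc x⟩
  have := h1 c⁻¹ (inv_pos.2 hc) _ h
  rwa [smul_smul, inv_mul_cancel₀ hc.ne', one_smul] at this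

/-- Minimality, tested against the image of the current under a radial diffeomorphism. -/
theorem mass_ball_le_lintegral_jacobian {C : Set (Euc N)} (hC : IsMetricCone n C) (hU : IsOpen U)
    {T : IntegerCurrent N n U} (hTC : supportIn U T.eval ⊆ C) (hbd : HasNoBoundary T)
    (hmin : IsMinimizingIn T (C ∩ U)) {R t : ℝ} (hR : 0 ≤ R) (hRt : R < t)
    (htU : closedBall 0 t ⊆ U) {h : ℝ → ℝ} (hh : IsSmallProfile R h) :
    T.mass (ball 0 t) ≤ ∫⁻ x in ball 0 t, ENNReal.ofReal (Real.exp (n * h (‖x‖ ^ 2)) *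
      shearJacobian (2 * deriv h (‖x‖ ^ 2)) x (T.frame x)) ∂T.mass := by
  have hRU : closedBall 0 R ⊆ U := (closedBall_subset_closedBall hRt.le).trans htU
  set G := hh.framedDiffeo hR T (ball_subset_closedBall.trans hRU)
  have hGF : ⇑G.F = radialMap N h := rfl
  have hsub1 := G.supportIn_push_sub_subset_closedBall hU fun x hx =>
    hh.radialMap_eq_self hR hx
  have hsub2 := G.supportIn_push_sub_subset hTC fun x =>
    hC.smul_mem_iff (Real.exp_pos (h (‖x‖ ^ 2))) x
  have hcl : closure (ball (0 : Euc N) t) ⊆ closedBall 0 t := closure_ball_subset_closedBall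
  have hle := hmin (ball 0 t) isOpen_ball
    ((isCompact_closedBall 0 t).of_isClosed_subset isClosed_closure hcl) (hcl.trans htU)
    G.push (G.sameBoundary_push hbd)
    (isCompact_supportIn_of_subset (isCompact_closedBall 0 R) hRU hsub1)
    fun x hx => ⟨⟨hsub2 hx, hx.1⟩, closedBall_subset_ball hRt (hsub1 hx)⟩
  rw [G.mass_push measurableSet_ball] at hle
  -- The diffeomorphism preserves `B_t`, since it is also the identity outside of `B_t`.
  have hht : IsSmallProfile t h :=
    ⟨hh.contDiff, fun u hu => hh.eq_zero u (le_trans (by gcongr) hu), hh.abs_apply_le,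
      hh.abs_deriv_le⟩
  have hpre : G.F ⁻¹' ball 0 t = ball 0 t := by
    ext x
    have := hht.norm_radialMap_lt_iff (hR.trans hRt.le) x
    simpa [hGF] using this
  rw [hpre] at hle
  exact hle

theorem deriv_eq_zero_of_forall_ge_eq_zero {ψ : ℝ → ℝ} {a u : ℝ} (hψ : ∀ u, a ≤ u → ψ u = 0)
    (hu : a < u) : deriv ψ u = 0 := by
  have : ψ =ᶠ[𝓝 u] fun _ => 0 := by
    filter_upwards [lt_mem_nhds hu] with v hv using hψ v hv.le
  rw [this.deriv_eq, deriv_const]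

theorem exists_forall_abs_le_of_forall_ge_eq_zero {ψ : ℝ → ℝ} {a : ℝ}
    (hψc : ContinuousOn ψ (Icc 0 a)) (hψ : ∀ u, a < u → ψ u = 0) : ∃ M, ∀ u, 0 ≤ u → |ψ u| ≤ M := by
  obtain ⟨M, hM⟩ := isCompact_Icc.exists_bound_of_continuousOn hψc
  refine ⟨max M 0, fun u hu => ?_⟩
  rcases le_or_gt u a with hua | hua
  · exact (hM u ⟨hu, hua⟩).trans (le_max_left _ _)
  · rw [hψ u hua, abs_zero]
    exact le_max_right _ _

/-- The first variation formula: for the radial field `ψ(|x|²) x`, which is tangent to the cone, the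
integral of the divergence along the current vanishes. -/
theorem integral_radial_divergence_eq_zero {C : Set (Euc N)} (hC : IsMetricCone n C)
    (hU : IsOpen U) {T : IntegerCurrent N n U} (hTC : supportIn U T.eval ⊆ C)
    (hbd : HasNoBoundary T) (hmin : IsMinimizingIn T (C ∩ U)) {R t : ℝ} (hR : 0 ≤ R) (hRt : R < t)
    (htU : closedBall 0 t ⊆ U) {ψ : ℝ → ℝ} (hψ : ContDiff ℝ ∞ ψ) (hψ0 : ∀ u, R ^ 2 ≤ u → ψ u = 0) :
    ∫ x in ball 0 t, (n * ψ (‖x‖ ^ 2) + 2 * deriv ψ (‖x‖ ^ 2) * tangentialSq x (T.frame x)) ∂T.mass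
      = 0 := by
  have hψ'c : Continuous (deriv ψ) := hψ.continuous_deriv (by simp)
  have hψ'0 : ∀ u, R ^ 2 < u → deriv ψ u = 0 := fun u hu =>
    deriv_eq_zero_of_forall_ge_eq_zero hψ0 hu
  obtain ⟨M₁, hM₁⟩ := exists_forall_abs_le_of_forall_ge_eq_zero hψ.continuous.continuousOn
    fun u hu => hψ0 u hu.le
  obtain ⟨M₂, hM₂⟩ := exists_forall_abs_le_of_forall_ge_eq_zero (a := R ^ 2)
    (ψ := fun u => deriv ψ u * u) (hψ'c.mul continuous_id).continuousOn
    fun u hu => by rw [hψ'0 u hu, zero_mul]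
  set M := max (max M₁ M₂) 1 with hM
  have hM1 : 1 ≤ M := le_max_right _ _
  have hMψ : ∀ u, 0 ≤ u → |ψ u| ≤ M := fun u hu =>
    (hM₁ u hu).trans ((le_max_left _ _).trans (le_max_left _ _))
  have hMψ' : ∀ u, 0 ≤ u → |deriv ψ u| * u ≤ M := fun u hu => by
    have := hM₂ u hu
    rw [abs_mul, abs_of_nonneg hu] at this
    exact this.trans ((le_max_right _ _).trans (le_max_left _ _))
  set d : Euc N → ℝ := fun x =>
    n * ψ (‖x‖ ^ 2) + 2 * deriv ψ (‖x‖ ^ 2) * tangentialSq x (T.frame x) with hd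
  set μ := T.mass.restrict (ball 0 t) with hμ
  have hfin : IsFiniteMeasure μ := ⟨by
    rw [hμ, Measure.restrict_apply_univ]
    exact (measure_mono ball_subset_closedBall).trans_lt
      (mass_lt_top T (isCompact_closedBall 0 t) htU)⟩
  have hdm : Measurable d := by
    have h1 := measurable_tangentialSq T
    have h2 := hψ.continuous.measurable
    have h3 := hψ'c.measurable
    fun_prop
  have hort : ∀ᵐ x ∂μ, Orthonormal ℝ (T.frame x) := by
    filter_upwards [ae_restrict_of_ae (ae_mult_ne_zero T)] with x hx using T.orthonormal x hx
  have hdb : ∀ᵐ x ∂μ, |d x| ≤ (n + 2) * M := by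
    filter_upwards [hort] with x hx
    have h1 := hMψ (‖x‖ ^ 2) (by positivity)
    have h2 := hMψ' (‖x‖ ^ 2) (by positivity)
    have h3 : |deriv ψ (‖x‖ ^ 2)| * tangentialSq x (T.frame x) ≤ M :=
      le_trans (by gcongr; exact tangentialSq_le hx x) h2
    calc |d x| ≤ |n * ψ (‖x‖ ^ 2)| + |2 * deriv ψ (‖x‖ ^ 2) * tangentialSq x (T.frame x)| :=
          abs_add_le _ _
      _ = n * |ψ (‖x‖ ^ 2)| + 2 * (|deriv ψ (‖x‖ ^ 2)| * tangentialSq x (T.frame x)) := by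
          rw [abs_mul, abs_mul, abs_mul, Nat.abs_cast, abs_two,
            abs_of_nonneg (tangentialSq_nonneg x _)]
          ring
      _ ≤ n * M + 2 * M := by gcongr
      _ = (n + 2) * M := by ring
  have hdi : Integrable d μ := Integrable.of_bound hdm.aestronglyMeasurable _ hdb
  -- `|τ| M₃` bounds the exponent of the Jacobian, and `B τ²` the remainder in its expansion.
  set M₃ := (n + 2) * M + 2 * M ^ 2 with hM₃
  have hM₃1 : 1 ≤ M₃ := by rw [hM₃]; nlinarith [(Nat.cast_nonneg n : (0 : ℝ) ≤ n)]
  have hM₃8 : 16 * M ≤ 16 * M₃ := by rw [hM₃]; nlinarith [(Nat.cast_nonneg n : (0 : ℝ) ≤ n)]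
  set B := 2 * M ^ 2 + M₃ ^ 2 with hB
  -- The second order expansion of the mass of the deformed current.
  have key : ∀ τ : ℝ, |τ| ≤ 1 / (16 * M₃) →
      0 ≤ τ * (∫ x, d x ∂μ) + τ ^ 2 * (B * μ.real univ) := by
    intro τ hτ
    rw [le_div_iff₀ (by positivity)] at hτ
    have hτM : |τ| * M ≤ 1 / 16 := by nlinarith [abs_nonneg τ]
    have hτ1 : |τ| ≤ 1 := by nlinarith [abs_nonneg τ]
    have hderiv : ∀ u, deriv (fun u => τ * ψ u) u = τ * deriv ψ u := fun u =>
      deriv_const_mul τ (hψ.differentiable (by simp) u)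
    have hh : IsSmallProfile R fun u => τ * ψ u := by
      refine ⟨contDiff_const.mul hψ, fun u hu => by simp [hψ0 u hu], fun u hu => ?_, fun u hu => ?_⟩
      · rw [abs_mul]
        have := mul_le_mul_of_nonneg_left (hMψ u hu) (abs_nonneg τ)
        linarith
      · rw [hderiv, abs_mul]
        have := mul_le_mul_of_nonneg_left (hMψ' u hu) (abs_nonneg τ)
        linarith
    have hle := mass_ball_le_lintegral_jacobian hC hU hTC hbd hmin hR hRt htU hh
    simp only [hderiv] at hle
    have hJ : ∀ᵐ x ∂μ, Real.exp (n * (τ * ψ (‖x‖ ^ 2))) *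
        shearJacobian (2 * (τ * deriv ψ (‖x‖ ^ 2))) x (T.frame x) ≤
        1 + τ * d x + B * τ ^ 2 := by
      filter_upwards [hort, hdb] with x hx hdx
      have hp0 := tangentialSq_nonneg x (T.frame x)
      have hp := tangentialSq_le hx x
      have h2 := hMψ' (‖x‖ ^ 2) (by positivity)
      set p := tangentialSq x (T.frame x)
      set k' := deriv ψ (‖x‖ ^ 2)
      have h3 : k' ^ 2 * ‖x‖ ^ 2 * p ≤ M ^ 2 := by
        calc k' ^ 2 * ‖x‖ ^ 2 * p ≤ k' ^ 2 * ‖x‖ ^ 2 * ‖x‖ ^ 2 := by gcongr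
          _ = (|k'| * ‖x‖ ^ 2) ^ 2 := by rw [mul_pow, sq_abs]; ring
          _ ≤ M ^ 2 := by gcongr
      have h4 : |τ * d x + 2 * M ^ 2 * τ ^ 2| ≤ |τ| * M₃ := by
        calc |τ * d x + 2 * M ^ 2 * τ ^ 2| ≤ |τ * d x| + |2 * M ^ 2 * τ ^ 2| := abs_add_le _ _
          _ = |τ| * |d x| + 2 * M ^ 2 * (|τ| * |τ|) := by
              rw [abs_mul, abs_of_nonneg (by positivity : 0 ≤ 2 * M ^ 2 * τ ^ 2), ← sq, sq_abs]
          _ ≤ |τ| * ((n + 2) * M) + 2 * M ^ 2 * (|τ| * 1) := by gcongr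
          _ = |τ| * M₃ := by rw [hM₃]; ring
      have h5 := Real.abs_exp_sub_one_sub_id_le (x := τ * d x + 2 * M ^ 2 * τ ^ 2)
        (h4.trans (by nlinarith [abs_nonneg τ]))
      have h6 : (τ * d x + 2 * M ^ 2 * τ ^ 2) ^ 2 ≤ τ ^ 2 * M₃ ^ 2 := by
        calc (τ * d x + 2 * M ^ 2 * τ ^ 2) ^ 2 = |τ * d x + 2 * M ^ 2 * τ ^ 2| ^ 2 :=
              (sq_abs _).symm
          _ ≤ (|τ| * M₃) ^ 2 := by gcongr
          _ = τ ^ 2 * M₃ ^ 2 := by rw [mul_pow, sq_abs]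
      have h7 := shearJacobian_le_exp (2 * (τ * k')) x (T.frame x)
      calc Real.exp (n * (τ * ψ (‖x‖ ^ 2))) * shearJacobian (2 * (τ * k')) x (T.frame x)
          ≤ Real.exp (n * (τ * ψ (‖x‖ ^ 2))) *
            Real.exp (2 * (τ * k') * p + (2 * (τ * k')) ^ 2 * ‖x‖ ^ 2 * p / 2) := by gcongr
        _ = Real.exp (τ * d x + 2 * (k' ^ 2 * ‖x‖ ^ 2 * p) * τ ^ 2) := by
            rw [← Real.exp_add, hd]
            congr 1
            ring
        _ ≤ Real.exp (τ * d x + 2 * M ^ 2 * τ ^ 2) := by gcongr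
        _ ≤ 1 + τ * d x + B * τ ^ 2 := by
            have := (abs_le.1 h5).2
            rw [hB]
            linarith
    have hint1 : Integrable (fun x => 1 + τ * d x) μ :=
      (integrable_const _).add (hdi.const_mul τ)
    have hint : Integrable (fun x => 1 + τ * d x + B * τ ^ 2) μ :=
      hint1.add (integrable_const _)
    have hnonneg : 0 ≤ᵐ[μ] fun x => 1 + τ * d x + B * τ ^ 2 := by
      filter_upwards [hJ] with x hx
      exact le_trans (mul_nonneg (Real.exp_pos _).le (Real.sqrt_nonneg _)) hx
    have hle2 : μ univ ≤ ENNReal.ofReal (∫ x, (1 + τ * d x + B * τ ^ 2) ∂μ) := by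
      rw [ofReal_integral_eq_lintegral_ofReal hint hnonneg, hμ, Measure.restrict_apply_univ]
      refine hle.trans (lintegral_mono_ae ?_)
      filter_upwards [hJ] with x hx using ENNReal.ofReal_le_ofReal hx
    have hle3 : μ.real univ ≤ ∫ x, (1 + τ * d x + B * τ ^ 2) ∂μ := by
      rw [measureReal_def]
      exact ENNReal.toReal_le_of_le_ofReal (integral_nonneg_of_ae hnonneg) hle2
    rw [integral_add hint1 (integrable_const _),
      integral_add (integrable_const _) (hdi.const_mul τ), integral_const_mul, integral_const,
      integral_const, smul_eq_mul, smul_eq_mul] at hle3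
    linarith
  -- An affine function of `τ` that is bounded below by `-O(τ²)` for both signs of `τ` is constant.
  set I := ∫ x, d x ∂μ with hI
  set m := B * μ.real univ with hm
  have hm0 : 0 ≤ m := by positivity
  have hδ : 0 < 1 / (16 * M₃) := by positivity
  have habs : ∀ τ : ℝ, 0 < τ → τ ≤ 1 / (16 * M₃) → |I| ≤ τ * m := by
    intro τ hτ0 hτ
    have h1 := key τ (by rwa [abs_of_pos hτ0])
    have h2 := key (-τ) (by rwa [abs_neg, abs_of_pos hτ0])
    rw [abs_le]
    constructor <;> nlinarith
  have hlim : Tendsto (fun τ : ℝ => τ * m) (𝓝[>] 0) (𝓝 0) := by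
    have : Tendsto (fun τ : ℝ => τ * m) (𝓝 0) (𝓝 (0 * m)) := (continuous_mul_const m).tendsto 0
    rw [zero_mul] at this
    exact this.mono_left nhdsWithin_le_nhds
  have hI0 : |I| ≤ 0 := by
    refine ge_of_tendsto hlim ?_
    filter_upwards [Ioc_mem_nhdsGT hδ] with τ hτ using habs τ hτ.1 hτ.2
  exact abs_nonpos_iff.1 hI0

end ConeMonotonicity

/-! ### Tangent planes of currents supported in a set -/

namespace ConeMonotonicity

open Filter Topology Asymptotics
open scoped NNReal ENNReal InnerProductSpace Pointwise

variable {N n : ℕ} {U : Set (Euc N)}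

/-- At its density points, a subset of a finite dimensional space has all vectors as tangent
vectors. -/
theorem ae_restrict_tangentConeAt_eq_univ {E : Type*} [NormedAddCommGroup E] [NormedSpace ℝ E]
    [FiniteDimensional ℝ E] [MeasurableSpace E] [BorelSpace E] (μ : Measure E) [μ.IsAddHaarMeasure]
    (s : Set E) : ∀ᵐ x ∂μ.restrict s, tangentConeAt ℝ s x = univ := by
  filter_upwards [Besicovitch.ae_tendsto_measure_inter_div μ s] with x hx
  refine eq_univ_of_forall fun z => ?_
  have hex : ∀ k : ℕ, ∃ r : ℝ, ∃ a : E, 0 < r ∧ r < 1 / ((k : ℝ) + 1) ∧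
      ‖a - z‖ ≤ 1 / ((k : ℝ) + 1) ∧ x + r • a ∈ s := by
    intro k
    have hk : 0 < 1 / ((k : ℝ) + 1) := by positivity
    have h1 := Measure.eventually_nonempty_inter_smul_of_density_one μ s x hx
      (closedBall z (1 / ((k : ℝ) + 1))) measurableSet_closedBall (measure_closedBall_pos μ z hk).ne'
    obtain ⟨r, ⟨y, hys, hy⟩, hr0, hr⟩ := (h1.and (Ioo_mem_nhdsGT hk)).exists
    simp only [mem_smul_set, image_add_left, mem_preimage, singleton_add] at hy
    obtain ⟨a, ha, hay⟩ := hy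
    refine ⟨r, a, hr0, hr, by simpa [dist_eq_norm] using ha, ?_⟩
    rw [hay]
    simpa using hys
  choose r a hr0 hr ha hs using hex
  have hlim := tendsto_one_div_add_atTop_nhds_zero_nat (𝕜 := ℝ)
  have hrlim : Tendsto r atTop (𝓝 0) :=
    squeeze_zero (fun k => (hr0 k).le) (fun k => (hr k).le) hlim
  have halim : Tendsto a atTop (𝓝 z) :=
    tendsto_iff_norm_sub_tendsto_zero.2 (squeeze_zero (fun _ => norm_nonneg _) ha hlim)
  refine mem_tangentConeAt_of_seq atTop (fun k => (r k)⁻¹) (fun k => r k • a k) ?_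
    (Eventually.of_forall hs) ?_
  · simpa using hrlim.smul halim
  · refine halim.congr fun k => ?_
    rw [smul_smul, inv_mul_cancel₀ (hr0 k).ne', one_smul]

/-- Almost every point of a subset `A` of a `C¹` submanifold `S` is a density point, and there the
tangent vectors of `A` span the tangent space of `S`. -/
theorem measure_not_tangentSpan_le_eq_zero {S A : Set (Euc N)}
    (hS : ∀ x ∈ S, IsSubmanifoldAt 1 n S x) (hA : A ⊆ S) :
    μHE[n] {x ∈ A | ¬ tangentSpan S x ≤ tangentSpan A x} = 0 := by
  refine measure_null_of_locally_null _ fun x₀ hx₀ => ?_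
  obtain ⟨-, Φ, L, hx₀Φ, hΦ, hΦ', hL, hΦL⟩ := hS x₀ (hA hx₀.1)
  -- Straighten `S` to the subspace `L`; the density theorem in `L` applies to the image `B` of `A`.
  set B : Set L := Subtype.val ⁻¹' (Φ '' (A ∩ Φ.source)) with hB
  set bad : Set L := {q ∈ B | tangentConeAt ℝ B q ≠ univ} with hbad
  have hbad0 : μHE[n] (Subtype.val '' bad) = 0 := by
    have h1 := ae_iff.1 (ae_restrict_tangentConeAt_eq_univ (volume : Measure L) B)
    have h2 : (volume : Measure L) bad = 0 := by
      refine le_antisymm (le_trans ?_ ((Measure.le_restrict_apply _ _).trans_eq h1)) zero_le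
      exact measure_mono fun q hq => ⟨hq.2, hq.1⟩
    rw [isometry_subtype_coe.euclideanHausdorffMeasure_image, ← hL,
      InnerProductSpace.euclideanHausdorffMeasure_eq_volume, h2]
  obtain ⟨D₀, -, h2₀⟩ := exists_hasStrictFDerivAt_equiv hΦ hΦ' hx₀Φ
  obtain ⟨K, W, hW, hKW⟩ := h2₀.exists_lipschitzOnWith
  refine ⟨{x ∈ A | ¬ tangentSpan S x ≤ tangentSpan A x} ∩ (Φ.source ∩ Φ ⁻¹' W), ?_, ?_⟩
  · exact inter_mem_nhdsWithin _ (inter_mem (Φ.open_source.mem_nhds hx₀Φ)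
      ((Φ.continuousAt hx₀Φ).preimage_mem_nhds hW))
  · have hnull : μHE[n] (Φ.symm '' (Subtype.val '' bad ∩ W)) = 0 := by
      have := (hKW.mono inter_subset_right
        (s := Subtype.val '' bad ∩ W)).euclideanHausdorffMeasure_image_le n
      rw [measure_mono_null inter_subset_left hbad0, mul_zero] at this
      exact le_antisymm this zero_le
    refine measure_mono_null ?_ hnull
    rintro x ⟨⟨hxA, hx⟩, hxΦ, hxW⟩
    have hxL : Φ x ∈ L := (hΦL x hxΦ).1 (hA hxA)
    refine ⟨Φ x, ⟨⟨⟨Φ x, hxL⟩, ⟨⟨x, ⟨hxA, hxΦ⟩, rfl⟩, fun hcone => hx ?_⟩, rfl⟩, hxW⟩,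
      Φ.left_inv hxΦ⟩
    obtain ⟨D, h1, h2⟩ := exists_hasStrictFDerivAt_equiv hΦ hΦ' hxΦ
    rw [tangentSpan_eq_comap (hA hxA) hxΦ h1 h2 hΦL]
    intro v hv
    refine Submodule.subset_span ?_
    have hv1 : (⟨D v, hv⟩ : L) ∈ tangentConeAt ℝ B ⟨Φ x, hxL⟩ := hcone ▸ mem_univ _
    have hv2 := (L.subtypeL.hasFDerivAt.hasFDerivWithinAt (s := B)).mapsTo_tangent_cone hv1
    have hv3 := (h2.hasFDerivAt.hasFDerivWithinAt
      (s := L.subtypeL '' B)).mapsTo_tangent_cone hv2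
    have heq : Φ.symm (L.subtypeL (⟨Φ x, hxL⟩ : L)) = x := Φ.left_inv hxΦ
    have heq' : Φ.symm (Φ x) = x := Φ.left_inv hxΦ
    have hDv : (D.symm : Euc N →L[ℝ] Euc N) (L.subtypeL (⟨D v, hv⟩ : L)) = v :=
      D.symm_apply_apply v
    rw [hDv] at hv3
    change v ∈ tangentConeAt ℝ _ (Φ.symm (Φ x)) at hv3
    rw [heq'] at hv3
    refine tangentConeAt_mono ?_ hv3
    rintro _ ⟨_, ⟨q, ⟨y, hy, hyq⟩, rfl⟩, rfl⟩
    change Φ.symm (q : Euc N) ∈ A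
    rw [← hyq, Φ.left_inv hy.2]
    exact hy.1

/-- Some alternating form does not vanish on a given orthonormal frame. -/
theorem exists_alternatingMap_apply_ne_zero {e : Fin n → Euc N} (he : Orthonormal ℝ e) :
    ∃ α : (Euc N) [⋀^Fin n]→L[ℝ] ℝ, α e ≠ 0 := by
  obtain ⟨ι, hι⟩ := exists_linearIsometry_eq_frameMap he
  set b := (EuclideanSpace.basisFun (Fin n) ℝ).toBasis with hb
  obtain ⟨r, hr⟩ := ι.toLinearMap.exists_leftInverse_of_injective
    (LinearMap.ker_eq_bot.2 ι.injective)
  set α := b.det.compLinearMap r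
  have hα : Continuous α := by
    change Continuous fun v : Fin n → Euc N => b.det fun i => r (v i)
    simp only [Module.Basis.det_apply]
    refine Continuous.matrix_det (continuous_matrix fun i j => ?_)
    exact ((b.coord i) ∘ₗ r).continuous_of_finiteDimensional.comp (continuous_apply j)
  refine ⟨⟨⟨α.toMultilinearMap, hα⟩,
    α.map_eq_zero_of_eq'⟩, ?_⟩
  change b.det (fun i => r (e i)) ≠ 0
  have : (fun i => r (e i)) = b := by
    ext1 i
    have h1 : e i = ι.toLinearMap (b i) := by
      rw [hι, hb, OrthonormalBasis.coe_toBasis, frameMap_basis]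
    rw [h1]
    exact congr($hr (b i))
  rw [this, b.det_self]
  exact one_ne_zero

instance finiteDimensional_continuousAlternatingMap :
    FiniteDimensional ℝ ((Euc N) [⋀^Fin n]→L[ℝ] ℝ) :=
  FiniteDimensional.of_injective
    (ContinuousAlternatingMap.toContinuousMultilinearMapCLM ℝ :
      (Euc N) [⋀^Fin n]→L[ℝ] ℝ →L[ℝ] ContinuousMultilinearMap ℝ (fun _ : Fin n => Euc N) ℝ).toLinearMap
    ContinuousAlternatingMap.toContinuousMultilinearMap_injective

/-- The action of a current as an integral with respect to its mass measure. -/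
theorem eval_eq_integral_mass (T : IntegerCurrent N n U) (w : Form N n) :
    T.eval w = ∫ x, ((T.mult x).sign : ℝ) * w x (T.frame x) ∂T.mass := by
  have hm : Measurable fun x => ((T.mult x).natAbs : ℝ≥0) :=
    (Measurable.of_discrete (f := fun k : ℤ => ((k.natAbs : ℕ) : ℝ≥0))).comp T.measurable_mult
  have h1 := integral_withDensity_eq_integral_smul (μ := (μHE[n] : Measure (Euc N))) hm
    fun x => ((T.mult x).sign : ℝ) * w x (T.frame x)
  simp only [ENNReal.coe_natCast] at h1
  rw [IntegerCurrent.mass, h1, IntegerCurrent.eval]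
  refine integral_congr_ae (Eventually.of_forall fun x => ?_)
  simp only [NNReal.smul_def, NNReal.coe_natCast, smul_eq_mul, ← mul_assoc]
  congr 1
  have h2 : ((T.mult x).natAbs : ℝ) * ((T.mult x).sign : ℝ) = T.mult x := by
    rw [mul_comm, ← Int.cast_natCast, ← Int.cast_mul, Int.sign_mul_natAbs]
  exact h2.symm

/-- A current which vanishes on all forms supported in an open set has no mass there. -/
theorem mass_eq_zero_of_forall_eval_eq_zero {T : IntegerCurrent N n U} {V : Set (Euc N)}
    (hV : IsOpen V) (hVU : V ⊆ U) (h : ∀ w : Form N n, IsTestForm V w → T.eval w = 0) :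
    T.mass V = 0 := by
  have hort : ∀ᵐ x ∂T.mass, Orthonormal ℝ (T.frame x) := by
    filter_upwards [ae_mult_ne_zero T] with x hx using T.orthonormal x hx
  have hα : ∀ α : (Euc N) [⋀^Fin n]→L[ℝ] ℝ, ∀ᵐ x ∂T.mass, x ∈ V →
      ((T.mult x).sign : ℝ) * α (T.frame x) = 0 := by
    intro α
    refine hV.ae_eq_zero_of_integral_contDiff_smul_eq_zero ?_ fun g hg hgc hgV => ?_
    · refine (locallyIntegrableOn_iff hV.isLocallyClosed).2 fun K hKV hK => ?_
      have hfin : T.mass K < ⊤ := mass_lt_top T hK (hKV.trans hVU)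
      have hm : Measurable fun x => ((T.mult x).sign : ℝ) * α (T.frame x) :=
        ((Measurable.of_discrete (f := fun k : ℤ => ((k.sign : ℤ) : ℝ))).comp
          T.measurable_mult).mul (α.cont.measurable.comp T.measurable_frame)
      have : IsFiniteMeasure (T.mass.restrict K) := ⟨by rwa [Measure.restrict_apply_univ]⟩
      refine Integrable.of_bound hm.aestronglyMeasurable ‖α‖ ?_
      filter_upwards [ae_restrict_of_ae hort] with x hx
      have h1 : ‖((T.mult x).sign : ℝ)‖ ≤ 1 := by
        rcases Int.sign_trichotomy (T.mult x) with h | h | h <;> simp [h]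
      have h2 : ‖α (T.frame x)‖ ≤ ‖α‖ := by
        have := α.le_opNorm (T.frame x)
        simpa [hx.1] using this
      rw [norm_mul]
      nlinarith [norm_nonneg (α (T.frame x)), norm_nonneg ((T.mult x).sign : ℝ)]
    · have htest : IsTestForm V fun x => g x • α :=
        ⟨hg.smul contDiff_const, hgc.smul_right, (tsupport_smul_subset_left g _).trans hgV⟩
      have := h _ htest
      rw [eval_eq_integral_mass] at this
      rw [← this]
      refine integral_congr_ae (Eventually.of_forall fun x => ?_)
      simp only [smul_eq_mul, ContinuousAlternatingMap.smul_apply]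
      ring
  -- Countably many constant forms `α` suffice to detect the frame at almost every point.
  obtain ⟨D, hDc, hDd⟩ := TopologicalSpace.exists_countable_dense ((Euc N) [⋀^Fin n]→L[ℝ] ℝ)
  have hall := (ae_ball_iff hDc).2 fun α _ => hα α
  have hV0 : ∀ᵐ x ∂T.mass, x ∉ V := by
    filter_upwards [hall, hort, ae_mult_ne_zero T] with x hx hxo hxm hxV
    obtain ⟨α, hαx⟩ := exists_alternatingMap_apply_ne_zero hxo
    refine hαx ?_
    have hcont : Continuous fun α : (Euc N) [⋀^Fin n]→L[ℝ] ℝ => α (T.frame x) := by fun_prop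
    refine congr_fun (hcont.ext_on hDd continuous_const (g := fun _ => (0 : ℝ)) fun α hαD => ?_) α
    have h0 := hx α hαD hxV
    rcases mul_eq_zero.1 h0 with h0 | h0
    · exact absurd (Int.sign_eq_zero_iff_zero.1 (by exact_mod_cast h0)) hxm
    · exact h0
  simpa using ae_iff.1 hV0

/-- The mass measure of a current is carried by its support. -/
theorem ae_mem_of_supportIn_subset {T : IntegerCurrent N n U} {C : Set (Euc N)}
    (hTC : supportIn U T.eval ⊆ C) : ∀ᵐ x ∂T.mass, x ∈ C := by
  have hU : ∀ᵐ x ∂T.mass, x ∈ U := by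
    filter_upwards [ae_mult_ne_zero T] with x hx using T.carrier_subset x hx
  have h0 : T.mass (U \ C) = 0 := by
    refine measure_null_of_locally_null _ fun x hx => ?_
    obtain ⟨V, hV, hVU, hxV, hVw⟩ :=
      exists_nhds_eq_zero_of_notMem_supportIn hx.1 fun h => hx.2 (hTC h)
    exact ⟨V, mem_nhdsWithin_of_mem_nhds (hV.mem_nhds hxV),
      mass_eq_zero_of_forall_eval_eq_zero hV hVU hVw⟩
  filter_upwards [hU, measure_eq_zero_iff_ae_notMem.1 h0] with x hxU hx
  by_contra hxC
  exact hx ⟨hxU, hxC⟩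

/-- Almost everywhere, the tangent plane of a current supported in `C` is tangent to `C`. -/
theorem ae_tangentPlane_le_tangentSpan {T : IntegerCurrent N n U} {C : Set (Euc N)}
    (hTC : supportIn U T.eval ⊆ C) : ∀ᵐ x ∂T.mass, T.tangentPlane x ≤ tangentSpan C x := by
  obtain ⟨S, hS1, hS2, hS3⟩ := T.rectifiable
  obtain ⟨Z, B, -, hZ0, -, hBS, hEZB, hBT⟩ := IsRectifiableWithFrame.exists_cover
    (e := T.frame) ⟨hS1, hS2, hS3⟩ (FramedDiffeo.measurableSet_carrier T)
  have hac : T.mass ≪ (μHE[n] : Measure (Euc N)) := withDensity_absolutelyContinuous _ _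
  have hZ : ∀ᵐ x ∂T.mass, x ∉ Z := measure_eq_zero_iff_ae_notMem.1 (hac hZ0)
  have hbad : ∀ᵐ x ∂T.mass, ∀ j, x ∉ {x ∈ C ∩ S j | ¬ tangentSpan (S j) x ≤
      tangentSpan (C ∩ S j) x} := ae_all_iff.2 fun j => measure_eq_zero_iff_ae_notMem.1
        (hac (measure_not_tangentSpan_le_eq_zero (hS1 j) inter_subset_right))
  filter_upwards [hZ, hbad, ae_mult_ne_zero T, ae_mem_of_supportIn_subset hTC] with x hxZ hx hxm hxC
  obtain ⟨j, hj⟩ := mem_iUnion.1 ((hEZB hxm).resolve_left hxZ)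
  have h1 : tangentSpan (S j) x ≤ tangentSpan (C ∩ S j) x := by
    by_contra hcon
    exact hx j ⟨⟨hxC, (hBS j hj).2⟩, hcon⟩
  rw [IntegerCurrent.tangentPlane, hBT j x hj]
  exact h1.trans (Submodule.span_mono (tangentConeAt_mono inter_subset_left))

/-- The position vector is tangent to a cone. -/
theorem IsMetricCone.self_mem_tangentSpan {C : Set (Euc N)} (hC : IsMetricCone n C) {x : Euc N}
    (hx : x ∈ C) : x ∈ tangentSpan C x := by
  refine Submodule.subset_span (mem_tangentConeAt_of_add_smul_mem (l := 𝓝[≠] (0 : ℝ)) (c := id)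
    tendsto_id ?_)
  have h1 : ∀ᶠ c : ℝ in 𝓝[≠] 0, -1 < c :=
    nhdsWithin_le_nhds (lt_mem_nhds (by norm_num))
  filter_upwards [h1] with c hc
  have : x + c • x = (1 + c) • x := by rw [add_smul, one_smul]
  rw [id, this]
  exact (hC.smul_mem_iff (by linarith) x).2 hx

/-- If `T_xΣ ⊆ T_xC` and `x ∈ T_xC`, then `x^⊥` is the component of `x` orthogonal to `T_xΣ` in the
whole space, so that `|x^⊥|² = |x|² - |x^T|²`. -/
theorem norm_perpIn_sq {T : IntegerCurrent N n U} {C : Set (Euc N)} {x : Euc N}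
    (he : Orthonormal ℝ (T.frame x)) (hT : T.tangentPlane x ≤ tangentSpan C x)
    (hx : x ∈ tangentSpan C x) :
    ‖perpIn C T x‖ ^ 2 = ‖x‖ ^ 2 - tangentialSq x (T.frame x) := by
  set e := T.frame x
  set y := ∑ k, ⟪x, e k⟫_ℝ • e k with hy
  have hyT : y ∈ T.tangentPlane x :=
    Submodule.sum_mem _ fun i _ => Submodule.smul_mem _ _ (Submodule.subset_span ⟨i, rfl⟩)
  have hey : ∀ i, ⟪e i, y⟫_ℝ = ⟪x, e i⟫_ℝ := fun i => he.inner_right_fintype _ i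
  have hxy : ⟪x, y⟫_ℝ = tangentialSq x e := by
    rw [hy, inner_sum, tangentialSq]
    exact Finset.sum_congr rfl fun i _ => by rw [inner_smul_right]; ring
  have hyy : ⟪y, y⟫_ℝ = tangentialSq x e := by
    conv_lhs => rw [hy, sum_inner]
    rw [tangentialSq]
    refine Finset.sum_congr rfl fun i _ => ?_
    rw [inner_smul_left, hey]
    simp [sq]
  have hperp : x - y ∈ (T.tangentPlane x)ᗮ := by
    rw [IntegerCurrent.tangentPlane, Submodule.mem_orthogonal]
    intro u hu
    induction hu using Submodule.span_induction with
    | mem u hu =>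
      obtain ⟨i, rfl⟩ := hu
      change ⟪e i, x - y⟫_ℝ = 0
      rw [inner_sub_right, hey, real_inner_comm, sub_self]
    | zero => simp
    | add u v _ _ hu hv => rw [inner_add_left, hu, hv, add_zero]
    | smul c u _ hu => rw [inner_smul_left, hu, mul_zero]
  have hproj : perpIn C T x = x - y := by
    refine Submodule.eq_starProjection_of_mem_of_inner_eq_zero
      ⟨Submodule.sub_mem _ hx (hT hyT), hperp⟩ fun w hw => ?_
    rw [sub_sub_cancel]
    exact Submodule.inner_right_of_mem_orthogonal hyT hw.2
  rw [hproj, norm_sub_sq_real, hxy, ← real_inner_self_eq_norm_sq y, hyy]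
  ring

end ConeMonotonicity

/-! ### Radial test functions for the monotonicity formula -/

namespace ConeMonotonicity

open Filter Topology Asymptotics
open scoped NNReal ENNReal InnerProductSpace

variable {N n : ℕ} {U : Set (Euc N)}

/-- The function `u ↦ ½ u^{-n/2-1}` on `[s², t²)`, extended by zero. In terms of `u = |x|²`, it is
the derivative of the profile `ψ` for which the divergence of `ψ(|x|²) x` along an `n`-plane that
contains `x` is `t^{-n} 1_{B_t} - s^{-n} 1_{B_s}`. -/
noncomputable def annulusDensity (n : ℕ) (s t : ℝ) : ℝ → ℝ :=
  (Ico (s ^ 2) (t ^ 2)).indicator fun u => 1 / 2 * (√u ^ (n + 2))⁻¹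

/-- The annulus density is the pointwise limit of a bounded sequence of smooth functions that vanish
near `t²` and beyond. -/
theorem exists_smooth_tendsto_annulusDensity (n : ℕ) {s t : ℝ} (hs : 0 < s) (hst : s < t) :
    ∃ (g : ℕ → ℝ → ℝ) (R : ℕ → ℝ) (M : ℝ), (∀ k, ContDiff ℝ ∞ (g k)) ∧
      (∀ k, 0 ≤ R k ∧ R k < t) ∧ (∀ k u, R k ^ 2 ≤ u → g k u = 0) ∧ (∀ k u, |g k u| ≤ M) ∧
      ∀ u, Tendsto (fun k => g k u) atTop (𝓝 (annulusDensity n s t u)) := by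
  have hs2 : 0 < s ^ 2 := by positivity
  have hst2 : s ^ 2 < t ^ 2 := by gcongr
  set a : ℕ → ℝ := fun k => k + 2 / s ^ 2 with ha
  have ha0 : ∀ k, 0 < a k := fun k => by positivity
  have has : ∀ k, 2 ≤ a k * s ^ 2 := fun k => by
    have : a k * s ^ 2 = k * s ^ 2 + 2 := by simp only [ha]; field_simp
    rw [this]
    have : (0 : ℝ) ≤ k * s ^ 2 := by positivity
    linarith
  have halim : Tendsto a atTop atTop :=
    tendsto_atTop_add_const_right _ _ tendsto_natCast_atTop_atTop
  set ρ : ℝ → ℝ := fun u => 1 / 2 * (√u ^ (n + 2))⁻¹ with hρ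
  -- The arguments are shifted so that the cut-offs are `1` at `s²` and `0` near `t²`, in agreement
  -- with the half-open interval `[s², t²)`.
  set χ : ℕ → ℝ → ℝ := fun k u =>
    Real.smoothTransition (a k * (u - s ^ 2) + 1) * Real.smoothTransition (a k * (t ^ 2 - u) - 1)
    with hχ
  have hχ0 : ∀ k u, u ≤ s ^ 2 / 2 → χ k u = 0 := fun k u hu => by
    simp only [hχ]
    rw [Real.smoothTransition.zero_of_nonpos, zero_mul]
    nlinarith [has k, ha0 k]
  have hχ01 : ∀ k u, |χ k u| ≤ 1 := fun k u => by
    simp only [hχ]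
    rw [abs_mul, abs_of_nonneg (Real.smoothTransition.nonneg _),
      abs_of_nonneg (Real.smoothTransition.nonneg _)]
    exact mul_le_one₀ (Real.smoothTransition.le_one _) (Real.smoothTransition.nonneg _)
      (Real.smoothTransition.le_one _)
  have hR : ∀ k, (a k)⁻¹ ≤ t ^ 2 := fun k => by
    rw [inv_le_iff_one_le_mul₀' (ha0 k)]
    nlinarith [has k, ha0 k]
  refine ⟨fun k u => ρ u * χ k u, fun k => √(t ^ 2 - (a k)⁻¹), ρ (s ^ 2 / 2), fun k => ?_,
    fun k => ⟨Real.sqrt_nonneg _, ?_⟩, fun k u hu => ?_, fun k u => ?_, fun u => ?_⟩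
  · have hχs : ContDiff ℝ ∞ (χ k) :=
      (Real.smoothTransition.contDiff.comp (by fun_prop)).mul
        (Real.smoothTransition.contDiff.comp (by fun_prop))
    refine contDiff_iff_contDiffAt.2 fun u => ?_
    rcases lt_or_ge u (s ^ 2 / 2) with hu | hu
    · have : (fun u => ρ u * χ k u) =ᶠ[𝓝 u] fun _ => 0 := by
        filter_upwards [gt_mem_nhds hu] with v hv
        rw [hχ0 k v (le_of_lt hv), mul_zero]
      exact contDiffAt_const.congr_of_eventuallyEq this
    · have hu0 : 0 < u := by linarith
      refine ContDiffAt.mul (contDiffAt_const.mul (ContDiffAt.inv ?_ ?_)) hχs.contDiffAt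
      · exact (Real.contDiffAt_sqrt hu0.ne').pow _
      · positivity
  · rw [Real.sqrt_lt' (hs.trans hst)]
    have := inv_pos.2 (ha0 k)
    linarith
  · rw [Real.sq_sqrt (by linarith [hR k])] at hu
    simp only [hχ]
    rw [Real.smoothTransition.zero_of_nonpos (x := a k * (t ^ 2 - u) - 1), mul_zero, mul_zero]
    have h1 : a k * (t ^ 2 - u) ≤ a k * (a k)⁻¹ :=
      mul_le_mul_of_nonneg_left (by linarith) (ha0 k).le
    rw [mul_inv_cancel₀ (ha0 k).ne'] at h1
    linarith
  · have hρs : 0 < ρ (s ^ 2 / 2) := by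
      have : 0 < √(s ^ 2 / 2) := Real.sqrt_pos.2 (by positivity)
      simp only [hρ]
      positivity
    change |ρ u * χ k u| ≤ ρ (s ^ 2 / 2)
    rcases le_or_gt u (s ^ 2 / 2) with hu | hu
    · rw [hχ0 k u hu, mul_zero, abs_zero]
      exact hρs.le
    · have h0 : 0 < √(s ^ 2 / 2) := Real.sqrt_pos.2 (by positivity)
      have h1 : |ρ u| ≤ ρ (s ^ 2 / 2) := by
        rw [abs_of_nonneg (by simp only [hρ]; positivity)]
        simp only [hρ]
        gcongr
      rw [abs_mul]
      calc |ρ u| * |χ k u| ≤ ρ (s ^ 2 / 2) * 1 := by gcongr; exact hχ01 k u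
        _ = _ := mul_one _
  · have heq : annulusDensity n s t u = ρ u * (if s ^ 2 ≤ u then 1 else 0) *
        (if u < t ^ 2 then 1 else 0) := by
      rw [annulusDensity, indicator_apply]
      by_cases h1 : s ^ 2 ≤ u <;> by_cases h2 : u < t ^ 2 <;> simp [h1, h2, hρ]
    rw [heq, mul_assoc]
    refine Tendsto.const_mul _ (Tendsto.mul ?_ ?_)
    · split_ifs with h
      · refine tendsto_const_nhds.congr fun k => (Real.smoothTransition.one_of_one_le ?_).symm
        have : 0 ≤ a k * (u - s ^ 2) := mul_nonneg (ha0 k).le (by linarith)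
        linarith
      · have h1 : Tendsto (fun k => a k * (s ^ 2 - u)) atTop atTop :=
          halim.atTop_mul_const (by linarith)
        refine tendsto_const_nhds.congr' ?_
        filter_upwards [h1.eventually_ge_atTop 1] with k hk
        refine (Real.smoothTransition.zero_of_nonpos ?_).symm
        linarith
    · split_ifs with h
      · have h1 : Tendsto (fun k => a k * (t ^ 2 - u)) atTop atTop :=
          halim.atTop_mul_const (by linarith)
        refine tendsto_const_nhds.congr' ?_
        filter_upwards [h1.eventually_ge_atTop 2] with k hk
        refine (Real.smoothTransition.one_of_one_le ?_).symm
        linarith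
      · refine tendsto_const_nhds.congr fun k => (Real.smoothTransition.zero_of_nonpos ?_).symm
        have : a k * (t ^ 2 - u) ≤ 0 := mul_nonpos_of_nonneg_of_nonpos (ha0 k).le (by linarith)
        linarith

theorem hasDerivAt_neg_inv_sqrt_pow (n : ℕ) {u : ℝ} (hu : 0 < u) :
    HasDerivAt (fun u => -(√u ^ n)⁻¹) (n * (1 / 2 * (√u ^ (n + 2))⁻¹)) u := by
  have h0 : 0 < √u := Real.sqrt_pos.2 hu
  have h := (((Real.hasDerivAt_sqrt hu.ne').fun_pow n).fun_inv (by positivity)).fun_neg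
  refine h.congr_deriv ?_
  rcases n with _ | n
  · simp
  · simp only [Nat.add_sub_cancel]
    field_simp
    ring

/-- The profile with derivative `annulusDensity`, up to a factor `n`. -/
theorem mul_integral_annulusDensity (n : ℕ) {s t u : ℝ} (hs : 0 < s) (hst : s < t)
    (hut : u < t ^ 2) : n * ∫ v in (t ^ 2)..u, annulusDensity n s t v =
      (t ^ n)⁻¹ - (√(max u (s ^ 2)) ^ n)⁻¹ := by
  have hs2 : 0 < s ^ 2 := by positivity
  have hst2 : s ^ 2 < t ^ 2 := by gcongr
  set m := max u (s ^ 2) with hm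
  have hmt : m ≤ t ^ 2 := max_le hut.le hst2.le
  have hm0 : 0 < m := hs2.trans_le (le_max_right _ _)
  have hset : (Ioc u (t ^ 2) ∩ Ico (s ^ 2) (t ^ 2) : Set ℝ) =ᵐ[volume] Ioc m (t ^ 2) := by
    have h1 : (Ioc u (t ^ 2) ∩ Ico (s ^ 2) (t ^ 2) : Set ℝ) =ᵐ[volume]
        (Ioc u (t ^ 2) ∩ Ioc (s ^ 2) (t ^ 2) : Set ℝ) :=
      (ae_eq_refl _).inter Ico_ae_eq_Ioc
    rwa [Ioc_inter_Ioc, inf_idem] at h1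
  have h1 : ∫ v in u..(t ^ 2), annulusDensity n s t v =
      ∫ v in m..(t ^ 2), 1 / 2 * (√v ^ (n + 2))⁻¹ := by
    rw [intervalIntegral.integral_of_le hut.le, intervalIntegral.integral_of_le hmt, annulusDensity,
      setIntegral_indicator measurableSet_Ico, setIntegral_congr_set hset]
  have hpos : ∀ v ∈ uIcc m (t ^ 2), 0 < v := fun v hv => by
    rw [uIcc_of_le hmt] at hv
    exact hm0.trans_le hv.1
  have h2 : ∫ v in m..(t ^ 2), (n : ℝ) * (1 / 2 * (√v ^ (n + 2))⁻¹) =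
      -(√(t ^ 2) ^ n)⁻¹ - -(√m ^ n)⁻¹ := by
    refine intervalIntegral.integral_eq_sub_of_hasDerivAt
      (fun v hv => hasDerivAt_neg_inv_sqrt_pow n (hpos v hv)) ?_
    refine ContinuousOn.intervalIntegrable fun v hv => ?_
    have h0 : 0 < √v := Real.sqrt_pos.2 (hpos v hv)
    have : √v ^ (n + 2) ≠ 0 := by positivity
    exact (by fun_prop (disch := exact this) :
      ContinuousAt (fun v => (n : ℝ) * (1 / 2 * (√v ^ (n + 2))⁻¹)) v).continuousWithinAt
  rw [intervalIntegral.integral_symm, h1, mul_neg, ← intervalIntegral.integral_const_mul, h2,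
    Real.sqrt_sq (hs.trans hst).le]
  ring

/-- The first variation formula for the profile with derivative `annulusDensity`. -/
theorem integral_annulus_divergence_eq_zero {C : Set (Euc N)} (hC : IsMetricCone n C)
    (hU : IsOpen U) {T : IntegerCurrent N n U} (hTC : supportIn U T.eval ⊆ C)
    (hbd : HasNoBoundary T) (hmin : IsMinimizingIn T (C ∩ U)) {s t : ℝ} (hs : 0 < s) (hst : s < t)
    (htU : closedBall 0 t ⊆ U) :
    Integrable (fun x => n * (∫ v in (t ^ 2)..‖x‖ ^ 2, annulusDensity n s t v) +
      2 * annulusDensity n s t (‖x‖ ^ 2) * tangentialSq x (T.frame x))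
        (T.mass.restrict (ball 0 t)) ∧
    ∫ x in ball 0 t, (n * (∫ v in (t ^ 2)..‖x‖ ^ 2, annulusDensity n s t v) +
      2 * annulusDensity n s t (‖x‖ ^ 2) * tangentialSq x (T.frame x)) ∂T.mass = 0 := by
  obtain ⟨g, R, M, hg, hR, hg0, hgM, hglim⟩ := exists_smooth_tendsto_annulusDensity n hs hst
  have hM0 : 0 ≤ M := (abs_nonneg _).trans (hgM 0 0)
  set μ := T.mass.restrict (ball 0 t) with hμ
  have hfin : IsFiniteMeasure μ := ⟨by
    rw [hμ, Measure.restrict_apply_univ]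
    exact (measure_mono ball_subset_closedBall).trans_lt
      (mass_lt_top T (isCompact_closedBall 0 t) htU)⟩
  set ψ : ℕ → ℝ → ℝ := fun k u => ∫ v in (t ^ 2)..u, g k v with hψ
  have hψd : ∀ k u, HasDerivAt (ψ k) (g k u) u := fun k u =>
    intervalIntegral.integral_hasDerivAt_right ((hg k).continuous.intervalIntegrable _ _)
      ((hg k).continuous.stronglyMeasurableAtFilter _ _) (hg k).continuous.continuousAt
  have hψ' : ∀ k, deriv (ψ k) = g k := fun k => funext fun u => (hψd k u).deriv
  have hψs : ∀ k, ContDiff ℝ ∞ (ψ k) := fun k => by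
    refine contDiff_infty_iff_deriv.2 ⟨fun u => (hψd k u).differentiableAt, ?_⟩
    rw [hψ']
    exact hg k
  have hψ0 : ∀ k u, R k ^ 2 ≤ u → ψ k u = 0 := fun k u hu => by
    have hRt : R k ^ 2 ≤ t ^ 2 := pow_le_pow_left₀ (hR k).1 (hR k).2.le 2
    refine (intervalIntegral.integral_congr (g := fun _ => (0 : ℝ)) fun v hv => ?_).trans
      (by simp)
    exact hg0 k v ((le_min hRt hu).trans hv.1)
  set f : ℕ → Euc N → ℝ := fun k x =>
    n * ψ k (‖x‖ ^ 2) + 2 * g k (‖x‖ ^ 2) * tangentialSq x (T.frame x) with hf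
  have hfint : ∀ k, ∫ x, f k x ∂μ = 0 := fun k => by
    have := integral_radial_divergence_eq_zero hC hU hTC hbd hmin (hR k).1 (hR k).2 htU (hψs k)
      (hψ0 k)
    simpa only [hψ'] using this
  have hfm : ∀ k, Measurable (f k) := fun k => by
    have h1 := measurable_tangentialSq T
    have h2 := (hψs k).continuous.measurable
    have h3 := (hg k).continuous.measurable
    fun_prop
  have hfb : ∀ k, ∀ᵐ x ∂μ, ‖f k x‖ ≤ n * (M * t ^ 2) + 2 * M * t ^ 2 := fun k => by
    filter_upwards [ae_restrict_of_ae (ae_mult_ne_zero T), ae_restrict_mem measurableSet_ball]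
      with x hx hxt
    have hxt2 : ‖x‖ ^ 2 ≤ t ^ 2 := by
      have : ‖x‖ < t := by simpa using hxt
      gcongr
    have h1 : |ψ k (‖x‖ ^ 2)| ≤ M * t ^ 2 := by
      have h2 := intervalIntegral.norm_integral_le_of_norm_le_const (a := t ^ 2) (b := ‖x‖ ^ 2)
        (f := g k) (C := M) fun v _ => hgM k v
      refine h2.trans ?_
      gcongr
      rw [abs_sub_comm, abs_of_nonneg (by linarith)]
      linarith [sq_nonneg ‖x‖]
    have h3 := tangentialSq_le (T.orthonormal x hx) x
    have h4 := tangentialSq_nonneg x (T.frame x)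
    calc ‖f k x‖ ≤ |n * ψ k (‖x‖ ^ 2)| + |2 * g k (‖x‖ ^ 2) * tangentialSq x (T.frame x)| :=
          abs_add_le _ _
      _ = n * |ψ k (‖x‖ ^ 2)| + 2 * |g k (‖x‖ ^ 2)| * tangentialSq x (T.frame x) := by
          rw [abs_mul, abs_mul, abs_mul, Nat.abs_cast, abs_two, abs_of_nonneg h4]
      _ ≤ n * (M * t ^ 2) + 2 * M * t ^ 2 := by
          gcongr
          · exact hgM k _
          · exact h3.trans hxt2
  have hflim : ∀ x, Tendsto (fun k => f k x) atTop
      (𝓝 (n * (∫ v in (t ^ 2)..‖x‖ ^ 2, annulusDensity n s t v) +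
        2 * annulusDensity n s t (‖x‖ ^ 2) * tangentialSq x (T.frame x))) := fun x => by
    refine Tendsto.add (Tendsto.const_mul _ ?_) (((hglim _).const_mul 2).mul_const _)
    refine intervalIntegral.tendsto_integral_filter_of_dominated_convergence (fun _ => M)
      (Eventually.of_forall fun k => (hg k).continuous.aestronglyMeasurable)
      (Eventually.of_forall fun k => Eventually.of_forall fun v _ => hgM k v)
      intervalIntegrable_const (Eventually.of_forall fun v _ => hglim v)
  have hae : AEStronglyMeasurable (fun x =>
      n * (∫ v in (t ^ 2)..‖x‖ ^ 2, annulusDensity n s t v) +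
        2 * annulusDensity n s t (‖x‖ ^ 2) * tangentialSq x (T.frame x)) μ :=
    aestronglyMeasurable_of_tendsto_ae atTop (fun k => (hfm k).aestronglyMeasurable)
      (Eventually.of_forall hflim)
  constructor
  · refine Integrable.of_bound hae (n * (M * t ^ 2) + 2 * M * t ^ 2) ?_
    filter_upwards [ae_all_iff.2 hfb] with x hx
    exact le_of_tendsto (hflim x).norm (Eventually.of_forall hx)
  · have h1 := tendsto_integral_of_dominated_convergence (μ := μ) _
      (fun k => (hfm k).aestronglyMeasurable) (integrable_const _) hfb (Eventually.of_forall hflim)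
    simp only [hfint] at h1
    exact tendsto_nhds_unique h1 tendsto_const_nhds

end ConeMonotonicity

/-! ### The monotonicity formula -/

theorem mainTheorem7 {N n : ℕ} (C : Set (ConeMonotonicity.Euc N))
    (hC : ConeMonotonicity.IsMetricCone n C)
    (U : Set (ConeMonotonicity.Euc N)) (hU : IsOpen U)
    (T : ConeMonotonicity.IntegerCurrent N n U)
    (hTC : ConeMonotonicity.supportIn U T.eval ⊆ C)
    (hbd : ConeMonotonicity.HasNoBoundary T)
    (hmin : ConeMonotonicity.IsMinimizingIn T (C ∩ U))
    (s t : ℝ) (hs : 0 < s) (hst : s < t) (htU : closedBall 0 t ⊆ U) :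
    IntegrableOn (fun x => ‖ConeMonotonicity.perpIn C T x‖ ^ 2 / ‖x‖ ^ (n + 2))
        (ball 0 t \ ball 0 s) T.mass ∧
      T.mass.real (ball 0 t) / t ^ n - T.mass.real (ball 0 s) / s ^ n =
        ∫ x in ball 0 t \ ball 0 s,
          ‖ConeMonotonicity.perpIn C T x‖ ^ 2 / ‖x‖ ^ (n + 2) ∂T.mass := by
  obtain ⟨hint, hzero⟩ :=
    ConeMonotonicity.integral_annulus_divergence_eq_zero hC hU hTC hbd hmin hs hst htU
  set μ := T.mass.restrict (ball 0 t) with hμ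
  have hfin : IsFiniteMeasure μ := ⟨by
    rw [hμ, Measure.restrict_apply_univ]
    exact (measure_mono ball_subset_closedBall).trans_lt
      (ConeMonotonicity.mass_lt_top T (isCompact_closedBall 0 t) htU)⟩
  set q : ConeMonotonicity.Euc N → ℝ := fun x =>
    ‖ConeMonotonicity.perpIn C T x‖ ^ 2 / ‖x‖ ^ (n + 2) with hq
  have hAm : MeasurableSet (ball (0 : ConeMonotonicity.Euc N) t \ ball 0 s) :=
    measurableSet_ball.diff measurableSet_ball
  have hBm : MeasurableSet (ball (0 : ConeMonotonicity.Euc N) s) := measurableSet_ball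
  -- The divergence integrand, computed with `|x^⊥|² = |x|² - |x^T|²`.
  have hae : (fun x => n * (∫ v in (t ^ 2)..‖x‖ ^ 2, ConeMonotonicity.annulusDensity n s t v) +
      2 * ConeMonotonicity.annulusDensity n s t (‖x‖ ^ 2) *
        ConeMonotonicity.tangentialSq x (T.frame x)) =ᵐ[μ]
      fun x => (t ^ n)⁻¹ - (ball 0 s).indicator (fun _ => (s ^ n)⁻¹) x -
        (ball 0 t \ ball 0 s).indicator q x := by
    filter_upwards [ae_restrict_mem measurableSet_ball,
      ae_restrict_of_ae (ConeMonotonicity.ae_mult_ne_zero T),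
      ae_restrict_of_ae (ConeMonotonicity.ae_mem_of_supportIn_subset hTC),
      ae_restrict_of_ae (ConeMonotonicity.ae_tangentPlane_le_tangentSpan hTC)] with x hxt hxm hxC hxT
    have hxt' : ‖x‖ < t := by simpa using hxt
    have hxt2 : ‖x‖ ^ 2 < t ^ 2 := by gcongr
    rw [ConeMonotonicity.mul_integral_annulusDensity n hs hst hxt2]
    by_cases hxs : x ∈ ball 0 s
    · have hxs' : ‖x‖ < s := by simpa using hxs
      have hxs2 : ‖x‖ ^ 2 < s ^ 2 := by gcongr
      rw [max_eq_right hxs2.le, Real.sqrt_sq hs.le, indicator_of_mem hxs,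
        indicator_of_notMem fun h => h.2 hxs, ConeMonotonicity.annulusDensity,
        indicator_of_notMem fun h => hxs2.not_ge h.1]
      ring
    · have hxs' : s ≤ ‖x‖ := by simpa using hxs
      have hxs2 : s ^ 2 ≤ ‖x‖ ^ 2 := by gcongr
      have hx0 : 0 < ‖x‖ := hs.trans_le hxs'
      rw [max_eq_left hxs2, Real.sqrt_sq (norm_nonneg _), indicator_of_notMem hxs,
        indicator_of_mem (show x ∈ ball 0 t \ ball 0 s from ⟨hxt, hxs⟩),
        ConeMonotonicity.annulusDensity,
        indicator_of_mem (show ‖x‖ ^ 2 ∈ Ico (s ^ 2) (t ^ 2) from ⟨hxs2, hxt2⟩),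
        Real.sqrt_sq (norm_nonneg _)]
      simp only [hq]
      rw [ConeMonotonicity.norm_perpIn_sq (T.orthonormal x hxm) hxT (hC.self_mem_tangentSpan hxC)]
      field_simp
      ring
  have hBi : Integrable ((ball (0 : ConeMonotonicity.Euc N) s).indicator fun _ => (s ^ n)⁻¹) μ :=
    (integrable_const _).indicator hBm
  have hi0 : Integrable (fun x => (t ^ n)⁻¹ -
      (ball (0 : ConeMonotonicity.Euc N) s).indicator (fun _ => (s ^ n)⁻¹) x) μ :=
    (integrable_const _).sub hBi
  have hqi : Integrable ((ball 0 t \ ball 0 s).indicator q) μ := by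
    refine (hi0.sub (hint.congr hae)).congr (Filter.Eventually.of_forall fun x => ?_)
    simp only [Pi.sub_apply]
    ring
  have hrestr : μ.restrict (ball 0 t \ ball 0 s) = T.mass.restrict (ball 0 t \ ball 0 s) := by
    rw [hμ, Measure.restrict_restrict hAm, inter_eq_left.2 sdiff_subset]
  have hμs : μ.real (ball 0 s) = T.mass.real (ball 0 s) := by
    rw [hμ, measureReal_restrict_apply hBm, inter_eq_left.2 (ball_subset_ball hst.le)]
  refine ⟨?_, ?_⟩
  · rw [IntegrableOn, ← hrestr]
    exact (integrable_indicator_iff hAm).1 hqi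
  · rw [integral_congr_ae hae, integral_sub hi0 hqi, integral_sub (integrable_const _) hBi,
      integral_indicator hAm, hrestr, integral_indicator hBm, integral_const, integral_const,
      smul_eq_mul, smul_eq_mul, measureReal_restrict_apply_univ, measureReal_restrict_apply_univ,
      hμs] at hzero
    rw [div_eq_mul_inv, div_eq_mul_inv]
    exact sub_eq_zero.1 hzero
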